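/- Let $k\ge 2$, $n\ge 1$, $\ell\ge 1$ be integers and $\gamma\in[0,1]$. Let $\triangle_k$ be the set of probability distributions on $[k]=\{1,\dots,k\}$, let $\mathcal Y=\{0,1\}^\ell$, and let $\mathcal W_\ell$ be the set of all randomized channels $W\colon[k]\to\mathcal Y$, with transition probabilities $W(y\mid x)$. Samples $X_1,\dots,X_n$ are drawn independently from an unknown $p\in\triangle_k$, one for each of $n$ users. A public-coin non-interactive scheme consists of public randomness $U$, independent of $X^n$, with an arbitrary law; channels $W_1,\dots,W_n\in\mathcal W_\ell$ that may depend on $U$; and an estimator $\hat p=\hat p(U,\cdot)\colon\mathcal Y^n\to\triangle_k$. Given $U$, user $i$ forms the message $Y_i\sim W_i(\cdot\mid X_i)$, independently over $i$. A $\gamma$-manipulation attack $M$ observes $U$ and $Y^n=(Y_1,\dots,Y_n)$, chooses a set $C\subseteq[n]$ with $|C|\le\gamma n$ (which may depend on $U$ and $Y^n$) and replaces the messages $Y_i$, $i\in C$, by arbitrary elements of $\mathcal Y$; the server receives the resulting vector $Z^n=M(U,Y^n)$. The minimax risk of distribution learning is \[ R_{\mathrm{DL}}(k,n,\mathcal W_\ell,\gamma)=\inf_{U,\,W^n,\,\hat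 p}\ \sup_{p\in\triangle_k}\ \sup_{M}\ \mathbb E\big[d_{\mathrm{TV}}(\hat p(U,Z^n),p)\big], \] where $d_{\mathrm{TV}}(p,q)=\frac12\sum_{x}|p(x)-q(x)|$. Put \[ r(k,n,\ell,\gamma)=\min\Big\{1,\ \sqrt{\frac{k^2}{n\,\min(2^\ell,k)}}+\gamma\sqrt{\frac{k}{\min(2^\ell,k)}}\Big\}. \] Then $R_{\mathrm{DL}}(k,n,\mathcal W_\ell,\gamma)=\tilde\Theta\big(r(k,n,\ell,\gamma)\big)$, with no logarithmic loss in the lower bound: there are universal constants $c,C>0$ and $a\in\mathbb N$ such that, for all $k\ge2$, $n\ge1$, $\ell\ge1$ and $\gamma\in[0,1]$, \[ c\; r(k,n,\ell,\gamma)\ \le\ R_{\mathrm{DL}}(k,n,\mathcal W_\ell,\gamma)\ \le\ C\,\big(\log (kn)\big)^{a}\; r(k,n,\ell,\gamma). \] -/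

import Mathlib

open MeasureTheory
open scoped ENNReal

noncomputable section

namespace ManipulationLearning

/-- The set of all probability distributions on a finite set `α`, as probability mass functions. -/
abbrev FinDist (α : Type) [Fintype α] : Type := stdSimplex ℝ α

/-- Total variation distance between distributions on a finite set. -/
def tvDist {α : Type} [Fintype α] (p q : FinDist α) : ℝ :=
  (1 / 2) * ∑ x, |p.1 x - q.1 x|

/-- A (randomized) channel from `[k]` to the finite message set `Y`:
`(W x).1 y` is the probability `W(y | x)` of sending `y` on input `x`. -/
abbrev Channel (k : ℕ) (Y : Type) [Fintype Y] : Type := Fin k → FinDist Y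

/-- The `ℓ`-bit communication constraint: all channels with message set `{0,1}^ℓ`. -/
def commChannels (k ℓ : ℕ) : Set (Channel k (Fin ℓ → Bool)) := Set.univ

/-- A public-coin non-interactive protocol for `n` users with channels in `𝒲`, with the estimator
of the server. The public randomness is a point `ω` of an arbitrary probability space; users choose
their channels, and the server its estimator, as functions of it. -/
structure Scheme (k n : ℕ) {Y : Type} [Fintype Y] (𝒲 : Set (Channel k Y)) where
  /-- sample space of the public randomness -/
  Ω : Type
  /-- its σ-algebra -/
  mΩ : MeasurableSpace Ω
  /-- law of the public randomness -/
  μ : Measure Ω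
  isProb : IsProbabilityMeasure μ
  /-- the channel of each user, given the public randomness -/
  channel : Ω → Fin n → Channel k Y
  channel_mem : ∀ ω i, channel ω i ∈ 𝒲
  /-- for every `x`, `y`, the probability `W_i(y | x)` is measurable in `ω` -/
  measurable_channel : ∀ i x y, Measurable fun ω => (channel ω i x).1 y
  /-- the estimator, given the public randomness and the received messages -/
  estimator : Ω → (Fin n → Y) → FinDist (Fin k)
  measurable_estimator : ∀ z x, Measurable fun ω => (estimator ω z).1 x

/-- A `γ`-manipulation attack on a scheme: having seen the public randomness `ω` and all intended
messages `y`, the adversary chooses a set `C` of at most `γ n` users and replaces their messages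
arbitrarily. -/
structure Attack {k n : ℕ} {Y : Type} [Fintype Y] {𝒲 : Set (Channel k Y)}
    (S : Scheme k n 𝒲) (γ : ℝ) where
  /-- the manipulated messages -/
  map : S.Ω → (Fin n → Y) → (Fin n → Y)
  /-- at most `γ n` messages are changed -/
  budget : ∀ ω y, ∃ C : Finset (Fin n), (C.card : ℝ) ≤ γ * n ∧ ∀ i, i ∉ C → map ω y i = y i
  /-- the attack is measurable in `ω` -/
  measurable_map : ∀ y z, MeasurableSet[S.mΩ] {ω | map ω y = z}

variable {k n : ℕ} {Y : Type} [Fintype Y] {𝒲 : Set (Channel k Y)}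

/-- The probability of the intended messages `y = (y_1, …, y_n)` under independent samples from `p`,
given the public randomness: `∏_i ∑_x p(x) W_i(y_i | x)`. -/
def Scheme.messageProb (S : Scheme k n 𝒲) (p : FinDist (Fin k)) (ω : S.Ω) (y : Fin n → Y) : ℝ :=
  ∏ i, ∑ x, p.1 x * (S.channel ω i x).1 (y i)

/-- The expected total variation loss `E[d_TV(p̂(Z^n), p)]`, over the samples, the channels and the
public randomness, under the attack `M`. -/
def Scheme.expectedLoss (S : Scheme k n 𝒲) {γ : ℝ} (M : Attack S γ) (p : FinDist (Fin k)) : ℝ≥0∞ :=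
  letI := S.mΩ
  ∫⁻ ω, ENNReal.ofReal
    (∑ y : Fin n → Y, S.messageProb p ω y * tvDist (S.estimator ω (M.map ω y)) p) ∂S.μ

/-- The minimax risk of distribution learning under channels from `𝒲` and `γ`-manipulation. -/
def riskDL (k n : ℕ) {Y : Type} [Fintype Y] (𝒲 : Set (Channel k Y)) (γ : ℝ) : ℝ≥0∞ :=
  ⨅ S : Scheme k n 𝒲, ⨆ p : FinDist (Fin k), ⨆ M : Attack S γ, S.expectedLoss M p

/-- The rate `√(k² / (n (2^ℓ ∧ k))) + γ √(k / (2^ℓ ∧ k))`, capped at `1`. -/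
def lbitRate (k n ℓ : ℕ) (γ : ℝ) : ℝ :=
  min 1 (√((k : ℝ) ^ 2 / ((n : ℝ) * min ((2 : ℝ) ^ ℓ) (k : ℝ)))
    + γ * √((k : ℝ) / min ((2 : ℝ) ^ ℓ) (k : ℝ)))

end ManipulationLearning

end

noncomputable section

namespace ManipulationLearning

/-! ### Expectations over finite product distributions -/

section ProductWeights

variable {ι α : Type} [Fintype ι] [Fintype α]

/-! Write `L = min(2^ℓ, k)`.

Upper bound. No shared randomness is used by the final scheme. The points of `[k]` are split into
`2^(ℓ-1)` buckets of at most `m = 3k/L` points, and the last bit of a message is a sign attached to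
the sample point, with a sign pattern that varies from user to user. For a fixed vector `v`, random
signs keep on average a fraction `1/(2√m)` of its `ℓ¹` norm under hashing: this is Khintchine's
inequality in each bucket, followed by Cauchy–Schwarz (`sum_hashNorm_ge`). Concentration and a union
bound then fix `n` hash functions that work for all differences of points of a finite net of
distributions (`exists_hashes`). The server compares net points by bounded tests, the signs of the
hashed differences, and takes the net point that fits the received messages best
(`tvDist_minDist_le`). Changing `γn` messages moves each test sum by at most `2γn`; sampling moves
all of them by `O(√(n k log(kn)))` in mean, since the net has `(kn+1)^k` indices. Dividing by the
separation, of order `n/√m`, gives the rate times a logarithm; where the separation fails, the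
claimed bound exceeds `1`.

Lower bound. The hard distributions perturb the uniform law on `⌊k/2⌋` pairs of points by a factor
`1 ± ε`, with one sign per pair. The two terms of the rate are obtained separately, for each fixed
value of the public randomness. For sampling, Assouad's method compares sign vectors that differ in
one pair. A message carries chi-square information `O(ε² L/k)` about all pairs together
(`sum_chiSq_le`), so `ε` of order `k/√(nL)`, capped at a constant, leaves a constant fraction of the
signs undetermined (`sum_loss_ge`). For manipulation, the law of a message is on average over the
signs within total variation `O(ε√(L/k))` of its law without perturbation
(`sum_sum_abs_outLaw_sub_le`). Once this is a small multiple of `γ`, a maximal coupling and Markov's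
inequality let the adversary imitate the unperturbed law within its budget (`attack_gain`), and then
the messages say nothing about the signs (`sum_best_response_ge`). -/

lemma sum_prod_weights_eq_one [DecidableEq ι] {w : ι → α → ℝ} (hw : ∀ i, ∑ a, w i a = 1) :
    ∑ a : ι → α, ∏ i, w i (a i) = 1 := by
  rw [← Fintype.prod_sum]
  simp [hw]

/-- A convexity bound for the moment generating function of a centred variable in `[-b, b]`. -/
lemma sum_mul_exp_le {w : α → ℝ} (hw0 : ∀ a, 0 ≤ w a) (hw : ∑ a, w a = 1) {X : α → ℝ} {b : ℝ}
    (hb : 0 < b) (hX : ∀ a, |X a| ≤ b) (hmean : ∑ a, w a * X a = 0) (t : ℝ) :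
    ∑ a, w a * Real.exp (t * X a) ≤ Real.exp ((t * b) ^ 2 / 2) := by
  -- Convexity puts `exp` below its chord over `[-tb, tb]`; the linear part of the chord averages to
  -- zero, which leaves `cosh (t b)`.
  have key : ∀ a, Real.exp (t * X a) ≤ Real.cosh (t * b) + X a / b * Real.sinh (t * b) := by
    intro a
    have h := abs_le.1 (hX a)
    have hc := convexOn_exp.2 (Set.mem_univ (t * b)) (Set.mem_univ (-(t * b)))
      (show 0 ≤ (1 + X a / b) / 2 by
          have : -1 ≤ X a / b := by rw [le_div_iff₀ hb]; linarith
          linarith)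
      (show 0 ≤ (1 - X a / b) / 2 by
          have : X a / b ≤ 1 := by rw [div_le_iff₀ hb]; linarith
          linarith) (by ring)
    simp only [smul_eq_mul] at hc
    rw [Real.cosh_eq, Real.sinh_eq]
    calc Real.exp (t * X a) = Real.exp ((1 + X a / b) / 2 * (t * b) + (1 - X a / b) / 2 * -(t * b)) := by
          congr 1; field_simp; ring
      _ ≤ _ := hc
      _ = _ := by ring
  calc ∑ a, w a * Real.exp (t * X a)
      ≤ ∑ a, w a * (Real.cosh (t * b) + X a / b * Real.sinh (t * b)) :=
        Finset.sum_le_sum fun a _ => mul_le_mul_of_nonneg_left (key a) (hw0 a)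
    _ = (∑ a, w a) * Real.cosh (t * b) + (∑ a, w a * X a) * (Real.sinh (t * b) / b) := by
        rw [Finset.sum_mul, Finset.sum_mul, ← Finset.sum_add_distrib]
        exact Finset.sum_congr rfl fun a _ => by ring
    _ = Real.cosh (t * b) := by rw [hw, hmean]; ring
    _ ≤ _ := Real.cosh_le_exp_half_sq _

lemma sum_prod_mul_exp_sum_le [DecidableEq ι] {w : ι → α → ℝ} (hw0 : ∀ i a, 0 ≤ w i a)
    (hw : ∀ i, ∑ a, w i a = 1) {X : ι → α → ℝ} {b : ℝ} (hb : 0 < b) (hX : ∀ i a, |X i a| ≤ b)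
    (hmean : ∀ i, ∑ a, w i a * X i a = 0) (t : ℝ) :
    ∑ a : ι → α, (∏ i, w i (a i)) * Real.exp (t * ∑ i, X i (a i))
      ≤ Real.exp (Fintype.card ι * ((t * b) ^ 2 / 2)) := by
  calc ∑ a : ι → α, (∏ i, w i (a i)) * Real.exp (t * ∑ i, X i (a i))
      = ∑ a : ι → α, ∏ i, (w i (a i) * Real.exp (t * X i (a i))) := by
        refine Finset.sum_congr rfl fun a _ => ?_
        rw [Finset.mul_sum, Real.exp_sum, Finset.prod_mul_distrib]
    _ = ∏ i, ∑ a, w i a * Real.exp (t * X i a) :=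
        (Fintype.prod_sum fun i a => w i a * Real.exp (t * X i a)).symm
    _ ≤ ∏ _i : ι, Real.exp ((t * b) ^ 2 / 2) := by
        refine Finset.prod_le_prod (fun i _ => ?_) fun i _ => ?_
        · exact Finset.sum_nonneg fun a _ => mul_nonneg (hw0 i a) (Real.exp_pos _).le
        · exact sum_mul_exp_le (hw0 i) (hw i) hb (hX i) (hmean i) t
    _ = _ := by
        rw [Finset.prod_const, Finset.card_univ, ← Real.exp_nat_mul]

/-- Maximal inequality: the expected maximal deviation, over a finite family, of a sum of
independent variables in `[-1, 1]` from its mean. -/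
lemma sum_prod_mul_maxDev_le [DecidableEq ι] [Nonempty ι] {V : Type} [Fintype V] [Nonempty V]
    {w : ι → α → ℝ} (hw0 : ∀ i a, 0 ≤ w i a)
    (hw : ∀ i, ∑ a, w i a = 1) {f : V → ι → α → ℝ} (hf : ∀ v i a, |f v i a| ≤ 1)
    {D : (ι → α) → ℝ}
    (hD : ∀ a, ∃ v, D a ≤ |∑ i, f v i (a i) - ∑ i, ∑ b, w i b * f v i b|) :
    ∑ a : ι → α, (∏ i, w i (a i)) * D a
      ≤ √(8 * Fintype.card ι * Real.log (2 * Fintype.card V)) := by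
  set n : ℝ := (Fintype.card ι : ℝ) with hn
  set K : ℝ := Real.log (2 * Fintype.card V) with hK
  have hn0 : 0 < n := by rw [hn]; exact_mod_cast Fintype.card_pos
  have hV1 : (1 : ℝ) ≤ Fintype.card V := by exact_mod_cast Fintype.card_pos
  have hK0 : 0 < K := Real.log_pos (by linarith)
  set X : V → ι → α → ℝ := fun v i a => f v i a - ∑ b, w i b * f v i b with hXdef
  have hmean_abs : ∀ v i, |∑ b, w i b * f v i b| ≤ 1 := by
    intro v i
    calc |∑ b, w i b * f v i b| ≤ ∑ b, |w i b * f v i b| := Finset.abs_sum_le_sum_abs _ _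
      _ ≤ ∑ b, w i b := Finset.sum_le_sum fun b _ => by
          rw [abs_mul, abs_of_nonneg (hw0 i b)]
          exact mul_le_of_le_one_right (hw0 i b) (hf v i b)
      _ = 1 := hw i
  have hX : ∀ v i a, |X v i a| ≤ 2 := fun v i a => by
    have h1 := abs_le.1 (hf v i a)
    have h2 := abs_le.1 (hmean_abs v i)
    exact abs_le.2 ⟨by simp only [hXdef]; linarith, by simp only [hXdef]; linarith⟩
  have hmean : ∀ v i, ∑ a, w i a * X v i a = 0 := fun v i => by
    simp only [hXdef, mul_sub, Finset.sum_sub_distrib, ← Finset.sum_mul, hw i]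
    ring
  have hP0 : ∀ a : ι → α, 0 ≤ ∏ i, w i (a i) := fun a => Finset.prod_nonneg fun i _ => hw0 i _
  -- This `t` makes the two summands of `A` equal: `K = n (2t)² / 2`, where `2` bounds the centred
  -- variables.
  set t : ℝ := √(K / (2 * n)) with ht
  have ht0 : 0 < t := Real.sqrt_pos.2 (by positivity)
  have ht2 : t ^ 2 = K / (2 * n) := Real.sq_sqrt (by positivity)
  set A : ℝ := K + n * ((t * 2) ^ 2 / 2) with hA
  have hA' : A = 2 * K := by
    rw [hA, mul_pow, ht2]; field_simp; ring
  have hexp : ∑ a : ι → α, (∏ i, w i (a i)) * Real.exp (t * D a) ≤ Real.exp A := by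
    calc ∑ a : ι → α, (∏ i, w i (a i)) * Real.exp (t * D a)
        ≤ ∑ a : ι → α, (∏ i, w i (a i)) * ∑ v, (Real.exp (t * ∑ i, X v i (a i))
            + Real.exp ((-t) * ∑ i, X v i (a i))) := by
          refine Finset.sum_le_sum fun a _ => mul_le_mul_of_nonneg_left ?_ (hP0 a)
          obtain ⟨v, hv⟩ := hD a
          have hv' : D a ≤ |∑ i, X v i (a i)| := by
            simpa [hXdef, Finset.sum_sub_distrib] using hv
          refine le_trans ?_ (Finset.single_le_sum
            (f := fun v => Real.exp (t * ∑ i, X v i (a i)) + Real.exp ((-t) * ∑ i, X v i (a i)))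
            (fun v _ => by positivity) (Finset.mem_univ v))
          rcases abs_cases (∑ i, X v i (a i)) with ⟨h, -⟩ | ⟨h, -⟩ <;> rw [h] at hv'
          · have : Real.exp (t * D a) ≤ Real.exp (t * ∑ i, X v i (a i)) :=
              Real.exp_le_exp.2 (mul_le_mul_of_nonneg_left hv' ht0.le)
            have := Real.exp_pos ((-t) * ∑ i, X v i (a i))
            linarith
          · have : Real.exp (t * D a) ≤ Real.exp ((-t) * ∑ i, X v i (a i)) :=
              Real.exp_le_exp.2 (by
                have := mul_le_mul_of_nonneg_left hv' ht0.le
                linarith)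
            have := Real.exp_pos (t * ∑ i, X v i (a i))
            linarith
      _ = ∑ v, (∑ a : ι → α, (∏ i, w i (a i)) * Real.exp (t * ∑ i, X v i (a i))
            + ∑ a : ι → α, (∏ i, w i (a i)) * Real.exp ((-t) * ∑ i, X v i (a i))) := by
          simp only [Finset.mul_sum, mul_add]
          rw [Finset.sum_comm]
          simp only [Finset.sum_add_distrib]
      _ ≤ ∑ _v : V, 2 * Real.exp (n * ((t * 2) ^ 2 / 2)) := by
          refine Finset.sum_le_sum fun v _ => ?_
          have h1 := sum_prod_mul_exp_sum_le hw0 hw two_pos (hX v) (hmean v) t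
          have h2 := sum_prod_mul_exp_sum_le hw0 hw two_pos (hX v) (hmean v) (-t)
          have e : (-t * 2) ^ 2 = (t * 2) ^ 2 := by ring
          rw [e] at h2
          linarith
      _ = Real.exp A := by
          rw [Finset.sum_const, Finset.card_univ, hA, Real.exp_add, hK,
            Real.exp_log (by linarith), nsmul_eq_mul]
          ring
  have hmain : t * ∑ a : ι → α, (∏ i, w i (a i)) * D a ≤ A := by
    calc t * ∑ a : ι → α, (∏ i, w i (a i)) * D a
        = ∑ a : ι → α, (∏ i, w i (a i)) * (t * D a) := by
          rw [Finset.mul_sum]; exact Finset.sum_congr rfl fun a _ => by ring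
      -- The tangent line of `exp` at `A`, that is `u ≤ A - 1 + exp (u - A)`, takes the place of
      -- Jensen's inequality.
      _ ≤ ∑ a : ι → α, (∏ i, w i (a i)) * ((A - 1) + Real.exp (-A) * Real.exp (t * D a)) := by
          refine Finset.sum_le_sum fun a _ => mul_le_mul_of_nonneg_left ?_ (hP0 a)
          rw [← Real.exp_add]
          have := Real.add_one_le_exp (-A + t * D a)
          linarith
      _ = (A - 1) * ∑ a : ι → α, (∏ i, w i (a i))
            + Real.exp (-A) * ∑ a : ι → α, (∏ i, w i (a i)) * Real.exp (t * D a) := by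
          rw [Finset.mul_sum, Finset.mul_sum, ← Finset.sum_add_distrib]
          exact Finset.sum_congr rfl fun a _ => by ring
      _ ≤ (A - 1) * 1 + Real.exp (-A) * Real.exp A := by
          rw [sum_prod_weights_eq_one hw]
          gcongr
      _ = A := by rw [← Real.exp_add]; simp
  have hs : t * √(8 * n * K) = 2 * K := by
    rw [ht, ← Real.sqrt_mul (by positivity)]
    have : K / (2 * n) * (8 * n * K) = (2 * K) ^ 2 := by field_simp; ring
    rw [this, Real.sqrt_sq (by positivity)]
  refine le_of_mul_le_mul_left ?_ ht0
  rw [hs, ← hA']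
  exact hmain

end ProductWeights

/-! ### A Khintchine inequality -/

/-- The sign of a bit. -/
def bitSign (b : Bool) : ℝ := if b then 1 else -1

lemma bitSign_not (b : Bool) : bitSign (!b) = -bitSign b := by cases b <;> simp [bitSign]

lemma bitSign_sq (b : Bool) : bitSign b ^ 2 = 1 := by cases b <;> simp [bitSign]

section Khintchine

variable {κ : Type} [DecidableEq κ]

/-- Averages of `s_a F(s)` vanish when `F` does not depend on the sign `s_a`. -/
lemma sum_bitSign_mul_eq_zero [Fintype κ] (a : κ) {F : (κ → Bool) → ℝ}
    (hF : ∀ s, F (Function.update s a (!(s a))) = F s) :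
    ∑ s : κ → Bool, bitSign (s a) * F s = 0 := by
  refine Finset.sum_involution (fun s _ => Function.update s a (!(s a))) ?_ ?_ ?_ ?_
  · intro s _
    rw [hF, Function.update_self, bitSign_not]; ring
  · intro s _ _ h
    have := congrFun h a
    simp at this
  · simp
  · intro s _; simp

/-- The signed sum of `v` over `A`. -/
def signedSum (A : Finset κ) (v : κ → ℝ) (s : κ → Bool) : ℝ := ∑ x ∈ A, bitSign (s x) * v x

lemma signedSum_insert {A : Finset κ} {a : κ} (ha : a ∉ A) (v : κ → ℝ) (s : κ → Bool) :
    signedSum (insert a A) v s = bitSign (s a) * v a + signedSum A v s :=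
  Finset.sum_insert ha

lemma signedSum_update {A : Finset κ} {a : κ} (ha : a ∉ A) (v : κ → ℝ) (s : κ → Bool) (b : Bool) :
    signedSum A v (Function.update s a b) = signedSum A v s := by
  refine Finset.sum_congr rfl fun x hx => ?_
  rw [Function.update_of_ne (by rintro rfl; exact ha hx)]

variable [Fintype κ]

lemma sum_signedSum_sq (A : Finset κ) (v : κ → ℝ) :
    ∑ s, signedSum A v s ^ 2 = 2 ^ Fintype.card κ * ∑ x ∈ A, v x ^ 2 := by
  induction A using Finset.induction_on with
  | empty => simp [signedSum]
  | insert a A ha ih =>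
    have h0 := sum_bitSign_mul_eq_zero a (F := signedSum A v) fun s => signedSum_update ha v s _
    calc ∑ s, signedSum (insert a A) v s ^ 2
        = ∑ s : κ → Bool, (v a ^ 2 + 2 * v a * (bitSign (s a) * signedSum A v s)
            + signedSum A v s ^ 2) := by
          refine Finset.sum_congr rfl fun s _ => ?_
          rw [signedSum_insert ha]
          linear_combination v a ^ 2 * bitSign_sq (s a)
      _ = _ := by
          rw [Finset.sum_add_distrib, Finset.sum_add_distrib, ← Finset.mul_sum, h0, ih,
            Finset.sum_insert ha]
          simp
          ring

/-- Adding one sign kills the odd cross terms, and `v⁴ + 6v²σ² + 3σ⁴ ≤ 3(σ² + v²)²` closes the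
induction. -/
lemma sum_signedSum_pow_four_le (A : Finset κ) (v : κ → ℝ) :
    ∑ s, signedSum A v s ^ 4 ≤ 2 ^ Fintype.card κ * (3 * (∑ x ∈ A, v x ^ 2) ^ 2) := by
  induction A using Finset.induction_on with
  | empty => simp [signedSum]
  | insert a A ha ih =>
    have h1 := sum_bitSign_mul_eq_zero a (F := signedSum A v) fun s => signedSum_update ha v s _
    have h3 := sum_bitSign_mul_eq_zero a (F := fun s => signedSum A v s ^ 3)
      fun s => by simp only [signedSum_update ha v s _]
    have h2 := sum_signedSum_sq A v
    calc ∑ s, signedSum (insert a A) v s ^ 4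
        = ∑ s : κ → Bool, (v a ^ 4 + 4 * v a ^ 3 * (bitSign (s a) * signedSum A v s)
            + 6 * v a ^ 2 * signedSum A v s ^ 2
            + 4 * v a * (bitSign (s a) * signedSum A v s ^ 3) + signedSum A v s ^ 4) := by
          refine Finset.sum_congr rfl fun s _ => ?_
          rw [signedSum_insert ha]
          linear_combination (v a ^ 4 * (bitSign (s a) ^ 2 + 1)
            + 4 * v a ^ 3 * bitSign (s a) * signedSum A v s
            + 6 * v a ^ 2 * signedSum A v s ^ 2) * bitSign_sq (s a)
      _ = 2 ^ Fintype.card κ * v a ^ 4 + 6 * v a ^ 2 * (2 ^ Fintype.card κ * ∑ x ∈ A, v x ^ 2)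
            + ∑ s, signedSum A v s ^ 4 := by
          simp only [Finset.sum_add_distrib, ← Finset.mul_sum, h1, h2, h3]
          simp
      _ ≤ 2 ^ Fintype.card κ * v a ^ 4 + 6 * v a ^ 2 * (2 ^ Fintype.card κ * ∑ x ∈ A, v x ^ 2)
            + 2 ^ Fintype.card κ * (3 * (∑ x ∈ A, v x ^ 2) ^ 2) := by gcongr
      _ ≤ _ := by
          rw [Finset.sum_insert ha]
          have : (0 : ℝ) ≤ 2 ^ Fintype.card κ * v a ^ 4 := by positivity
          nlinarith

/-- The fourth moment method: a variable whose fourth moment is at most three times the square of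
its second moment has a first moment comparable to its standard deviation. -/
lemma sum_abs_signedSum_ge (A : Finset κ) (v : κ → ℝ) :
    2 ^ Fintype.card κ * (√(∑ x ∈ A, v x ^ 2) / 2) ≤ ∑ s, |signedSum A v s| := by
  set σ := √(∑ x ∈ A, v x ^ 2) with hσ
  have hσ2 : σ ^ 2 = ∑ x ∈ A, v x ^ 2 := Real.sq_sqrt (Finset.sum_nonneg fun x _ => sq_nonneg _)
  rcases (show 0 ≤ σ from Real.sqrt_nonneg _).eq_or_lt with h0 | hpos
  · rw [show σ = 0 from h0.symm]; simpa using Finset.sum_nonneg fun s _ => abs_nonneg _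
  -- On average the left side is at least `σ⁴ - 3σ⁴/6 = σ⁴/2`. The inequality holds because `y (σ -
  -- 2y/3)² (σ + y/3) = σ³y - σ²y² + 4y⁴/27` and `4/27 ≤ 1/6`.
  have hpt : ∀ z : ℝ, σ ^ 2 * z ^ 2 - z ^ 4 / 6 ≤ σ ^ 3 * |z| := by
    intro z
    have hz := abs_nonneg z
    rw [← sq_abs z, show z ^ 4 = |z| ^ 4 by rw [← abs_pow, abs_of_nonneg (by positivity)]]
    generalize |z| = y at hz
    have h1 : 0 ≤ (σ - 2 * y / 3) ^ 2 * (σ + y / 3) := by positivity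
    have h2 : 0 ≤ y * ((σ - 2 * y / 3) ^ 2 * (σ + y / 3)) := by positivity
    nlinarith [pow_nonneg hz 4]
  have hsum := Finset.sum_le_sum fun (s : κ → Bool) (_ : s ∈ Finset.univ) => hpt (signedSum A v s)
  rw [Finset.sum_sub_distrib, ← Finset.mul_sum, ← Finset.sum_div, ← Finset.mul_sum,
    sum_signedSum_sq, ← hσ2] at hsum
  have h4 := sum_signedSum_pow_four_le A v
  rw [← hσ2] at h4
  refine le_of_mul_le_mul_left ?_ (pow_pos hpos 3)
  refine le_trans ?_ hsum
  nlinarith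

lemma sum_abs_signedSum_ge_sum_abs {A : Finset κ} {m : ℝ} (hm : 0 < m) (hA : (A.card : ℝ) ≤ m)
    (v : κ → ℝ) :
    2 ^ Fintype.card κ * ((∑ x ∈ A, |v x|) / (2 * √m)) ≤ ∑ s, |signedSum A v s| := by
  refine le_trans ?_ (sum_abs_signedSum_ge A v)
  have h : ∑ x ∈ A, |v x| ≤ √m * √(∑ x ∈ A, v x ^ 2) := by
    rw [← Real.sqrt_mul hm.le]
    refine Real.le_sqrt_of_sq_le ?_
    calc (∑ x ∈ A, |v x|) ^ 2 ≤ A.card * ∑ x ∈ A, |v x| ^ 2 := sq_sum_le_card_mul_sum_sq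
      _ ≤ m * ∑ x ∈ A, v x ^ 2 := by
        simp only [sq_abs]
        exact mul_le_mul_of_nonneg_right hA (Finset.sum_nonneg fun x _ => sq_nonneg _)
  have hs : 0 < √m := Real.sqrt_pos.2 hm
  refine mul_le_mul_of_nonneg_left ?_ (by positivity)
  rw [div_le_iff₀ (by positivity)]
  linarith

end Khintchine

/-! ### Maximal deviations -/

section MaxDev

variable {ι α V : Type} [Fintype ι] [Fintype α] [Fintype V] [Nonempty V]

/-- The maximal deviation, over the family `f`, of `∑ i, f v i (a i)` from its mean under the
product of the weights `w i`. -/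
def maxDev (w : ι → α → ℝ) (f : V → ι → α → ℝ) (a : ι → α) : ℝ :=
  Finset.univ.sup' Finset.univ_nonempty
    fun v => |∑ i, f v i (a i) - ∑ i, ∑ b, w i b * f v i b|

lemma le_maxDev (w : ι → α → ℝ) (f : V → ι → α → ℝ) (a : ι → α) (v : V) :
    |∑ i, f v i (a i) - ∑ i, ∑ b, w i b * f v i b| ≤ maxDev w f a :=
  Finset.le_sup' (fun v => |∑ i, f v i (a i) - ∑ i, ∑ b, w i b * f v i b|) (Finset.mem_univ v)

lemma maxDev_le {w : ι → α → ℝ} {f : V → ι → α → ℝ} {a : ι → α} {E : ℝ}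
    (h : ∀ v, |∑ i, f v i (a i) - ∑ i, ∑ b, w i b * f v i b| ≤ E) : maxDev w f a ≤ E :=
  Finset.sup'_le _ _ fun v _ => h v

lemma sum_prod_mul_maxDev_le' [DecidableEq ι] [Nonempty ι] {w : ι → α → ℝ}
    (hw0 : ∀ i a, 0 ≤ w i a) (hw : ∀ i, ∑ a, w i a = 1) {f : V → ι → α → ℝ}
    (hf : ∀ v i a, |f v i a| ≤ 1) :
    ∑ a : ι → α, (∏ i, w i (a i)) * maxDev w f a
      ≤ √(8 * Fintype.card ι * Real.log (2 * Fintype.card V)) := by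
  refine sum_prod_mul_maxDev_le hw0 hw hf fun a => ?_
  obtain ⟨v, -, hv⟩ := Finset.exists_mem_eq_sup' Finset.univ_nonempty
    fun v => |∑ i, f v i (a i) - ∑ i, ∑ b, w i b * f v i b|
  exact ⟨v, hv.le⟩

/-- The probabilistic method: some outcome is no worse than the mean. -/
lemma exists_maxDev_le [DecidableEq ι] [Nonempty ι] {w : ι → α → ℝ} (hw0 : ∀ i a, 0 < w i a)
    (hw : ∀ i, ∑ a, w i a = 1) {f : V → ι → α → ℝ} (hf : ∀ v i a, |f v i a| ≤ 1) :
    ∃ a, maxDev w f a ≤ √(8 * Fintype.card ι * Real.log (2 * Fintype.card V)) := by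
  by_contra! hcon
  have h := sum_prod_mul_maxDev_le' (fun i a => (hw0 i a).le) hw hf
  set E := √(8 * Fintype.card ι * Real.log (2 * Fintype.card V))
  have hne : (Finset.univ : Finset (ι → α)).Nonempty := by
    rw [Finset.nonempty_iff_ne_empty]
    intro h0
    have := sum_prod_weights_eq_one hw
    rw [h0] at this
    simp at this
  have h2 : ∑ a : ι → α, (∏ i, w i (a i)) * E < ∑ a : ι → α, (∏ i, w i (a i)) * maxDev w f a :=
    Finset.sum_lt_sum_of_nonempty hne fun a _ =>
      mul_lt_mul_of_pos_left (hcon a) (Finset.prod_pos fun i _ => hw0 i _)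
  rw [← Finset.sum_mul, sum_prod_weights_eq_one hw] at h2
  linarith

end MaxDev

/-! ### Hashing -/

section Hashing

variable {k : ℕ} {Y : Type} [DecidableEq Y]

/-- The push-forward of the weights `v` under the hash function `h`. -/
def hashMass (h : Fin k → Y) (v : Fin k → ℝ) (y : Y) : ℝ := ∑ x with h x = y, v x

/-- The sign of the push-forward of `v` under `h`. -/
def hashSign (h : Fin k → Y) (v : Fin k → ℝ) (y : Y) : ℝ := if 0 ≤ hashMass h v y then 1 else -1

lemma abs_hashSign (h : Fin k → Y) (v : Fin k → ℝ) (y : Y) : |hashSign h v y| = 1 := by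
  unfold hashSign; split_ifs <;> simp

lemma hashMass_mul_hashSign (h : Fin k → Y) (v : Fin k → ℝ) (y : Y) :
    hashMass h v y * hashSign h v y = |hashMass h v y| := by
  unfold hashSign
  split_ifs with h0
  · rw [abs_of_nonneg h0, mul_one]
  · rw [abs_of_neg (not_le.1 h0)]; ring

lemma hashMass_sub (h : Fin k → Y) (v w : Fin k → ℝ) (y : Y) :
    hashMass h (v - w) y = hashMass h v y - hashMass h w y := by
  simp [hashMass, Finset.sum_sub_distrib]

lemma hashMass_nonneg (h : Fin k → Y) {v : Fin k → ℝ} (hv : ∀ x, 0 ≤ v x) (y : Y) :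
    0 ≤ hashMass h v y := Finset.sum_nonneg fun x _ => hv x

variable [Fintype Y]

/-- The `ℓ¹` norm of the push-forward of `v` under `h`. -/
def hashNorm (h : Fin k → Y) (v : Fin k → ℝ) : ℝ := ∑ y, |hashMass h v y|

lemma sum_hashMass (h : Fin k → Y) (v : Fin k → ℝ) : ∑ y, hashMass h v y = ∑ x, v x :=
  Finset.sum_fiberwise _ _ _

lemma hashNorm_nonneg (h : Fin k → Y) (v : Fin k → ℝ) : 0 ≤ hashNorm h v :=
  Finset.sum_nonneg fun _ _ => abs_nonneg _

lemma hashNorm_le (h : Fin k → Y) (v : Fin k → ℝ) : hashNorm h v ≤ ∑ x, |v x| := by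
  rw [← sum_hashMass h fun x => |v x|]
  exact Finset.sum_le_sum fun y _ => Finset.abs_sum_le_sum_abs _ _

lemma abs_sum_hashMass_mul_le (h : Fin k → Y) (v : Fin k → ℝ) {f : Y → ℝ} (hf : ∀ y, |f y| ≤ 1) :
    |∑ y, hashMass h v y * f y| ≤ ∑ x, |v x| := by
  refine le_trans ?_ (hashNorm_le h v)
  refine (Finset.abs_sum_le_sum_abs _ _).trans (Finset.sum_le_sum fun y _ => ?_)
  rw [abs_mul]
  exact mul_le_of_le_one_right (abs_nonneg _) (hf y)

/-- The two cells of bucket `b` receive masses whose difference is the signed sum of `v` over the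
bucket, so the triangle inequality bounds the hashed norm below by the sum over buckets of absolute
signed sums. Khintchine's inequality then applies in each bucket. -/
lemma sum_hashNorm_ge {B : Type} [Fintype B] [DecidableEq B] {φ : B × Bool → Y}
    (hφ : Function.Injective φ) (g : Fin k → B) {m : ℝ} (hm : 0 < m)
    (hg : ∀ b, (({x | g x = b} : Finset (Fin k)).card : ℝ) ≤ m) (v : Fin k → ℝ) :
    2 ^ k * ((∑ x, |v x|) / (2 * √m))
      ≤ ∑ s : Fin k → Bool, hashNorm (fun x => φ (g x, s x)) v := by
  have hpt : ∀ s : Fin k → Bool,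
      ∑ b, |signedSum {x | g x = b} v s| ≤ hashNorm (fun x => φ (g x, s x)) v := by
    intro s
    have h1 : ∑ c : B × Bool, |hashMass (fun x => φ (g x, s x)) v (φ c)|
        ≤ hashNorm (fun x => φ (g x, s x)) v := by
      rw [← Finset.sum_image (s := Finset.univ) (g := φ)
        (f := fun y => |hashMass (fun x => φ (g x, s x)) v y|) (fun a _ b _ h => hφ h)]
      exact Finset.sum_le_sum_of_subset_of_nonneg (Finset.subset_univ _)
        fun _ _ _ => abs_nonneg _
    refine le_trans ?_ h1
    rw [Fintype.sum_prod_type]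
    refine Finset.sum_le_sum fun b _ => ?_
    have h2 : signedSum {x | g x = b} v s = hashMass (fun x => φ (g x, s x)) v (φ (b, true))
        - hashMass (fun x => φ (g x, s x)) v (φ (b, false)) := by
      simp only [signedSum, hashMass, hφ.eq_iff, Prod.mk.injEq, Finset.sum_filter,
        ← Finset.sum_sub_distrib]
      refine Finset.sum_congr rfl fun x _ => ?_
      by_cases hx : g x = b <;> cases hs : s x <;> simp [hx, bitSign]
    rw [h2, Fintype.sum_bool]
    exact abs_sub _ _
  refine le_trans ?_ (Finset.sum_le_sum fun s _ => hpt s)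
  rw [Finset.sum_comm]
  calc 2 ^ k * ((∑ x, |v x|) / (2 * √m))
      = ∑ b, 2 ^ Fintype.card (Fin k) * ((∑ x with g x = b, |v x|) / (2 * √m)) := by
        rw [← Finset.mul_sum, ← Finset.sum_div, Finset.sum_fiberwise, Fintype.card_fin]
    _ ≤ _ := Finset.sum_le_sum fun b _ => sum_abs_signedSum_ge_sum_abs hm (hg b) v

/-- There are `n` hash functions for which the average `ℓ¹` norm of push-forwards is, for all
vectors of a finite family, not much smaller than the `ℓ¹` norm divided by `√m`, where `m` is the
number of points per pair of messages. -/
lemma exists_hashes {B : Type} [Fintype B] [DecidableEq B] {φ : B × Bool → Y}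
    (hφ : Function.Injective φ) (g : Fin k → B) {m : ℝ} (hm : 0 < m)
    (hg : ∀ b, (({x | g x = b} : Finset (Fin k)).card : ℝ) ≤ m)
    {V : Type} [Fintype V] [Nonempty V] (v : V → Fin k → ℝ) {n : ℕ} (hn : 1 ≤ n) :
    ∃ h : Fin n → Fin k → Y, ∀ j,
      (n / (2 * √m) - √(8 * n * Real.log (2 * Fintype.card V))) * ∑ x, |v j x|
        ≤ ∑ i, hashNorm (h i) (v j) := by
  have : Nonempty (Fin n) := ⟨⟨0, hn⟩⟩
  set w : Fin n → (Fin k → Bool) → ℝ := fun _ _ => (2 ^ k)⁻¹ with hw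
  -- Normalizing by the `ℓ¹` norm puts the variables in `[0, 1]`, so one deviation bound serves
  -- vectors of all sizes; zero vectors are treated apart below.
  set f : V → Fin n → (Fin k → Bool) → ℝ :=
    fun j _ s => hashNorm (fun x => φ (g x, s x)) (v j) / ∑ x, |v j x| with hfdef
  have hl1 : ∀ j, 0 ≤ ∑ x, |v j x| := fun j => Finset.sum_nonneg fun _ _ => abs_nonneg _
  obtain ⟨s, hs⟩ := exists_maxDev_le (w := w) (f := f) (fun _ _ => by positivity)
    (fun _ => by simp [hw]) (fun j i s => by
      rw [abs_of_nonneg (div_nonneg (hashNorm_nonneg _ _) (hl1 j))]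
      exact div_le_one_of_le₀ (hashNorm_le _ _) (hl1 j))
  rw [Fintype.card_fin] at hs
  refine ⟨fun i x => φ (g x, s i x), fun j => ?_⟩
  rcases (hl1 j).eq_or_lt with h0 | hpos
  · rw [← h0, mul_zero]; exact Finset.sum_nonneg fun i _ => hashNorm_nonneg _ _
  have hd := (abs_le.1 ((le_maxDev w f s j).trans hs)).1
  have hmean : n / (2 * √m) ≤ ∑ i, ∑ b, w i b * f j i b := by
    have h1 : 1 / (2 * √m) ≤ ∑ b : Fin k → Bool,
        (2 ^ k : ℝ)⁻¹ * (hashNorm (fun x => φ (g x, b x)) (v j) / ∑ x, |v j x|) := by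
      rw [← Finset.mul_sum, ← Finset.sum_div]
      have := sum_hashNorm_ge hφ g hm hg (v j)
      rw [le_inv_mul_iff₀ (by positivity), le_div_iff₀ hpos]
      calc _ = _ := by ring
        _ ≤ _ := this
    calc (n : ℝ) / (2 * √m) = ∑ _i : Fin n, 1 / (2 * √m) := by
          rw [Finset.sum_const, Finset.card_univ, Fintype.card_fin, nsmul_eq_mul]; ring
      _ ≤ _ := Finset.sum_le_sum fun i _ => h1
  have h3 : (n / (2 * √m) - √(8 * n * Real.log (2 * Fintype.card V))) ≤ ∑ i, f j i (s i) := by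
    linarith
  simp only [hfdef, ← Finset.sum_div] at h3
  rwa [le_div_iff₀ hpos] at h3

end Hashing

/-! ### The minimum distance estimator -/

lemma tvDist_eq {α : Type} [Fintype α] (p q : FinDist α) :
    tvDist p q = (1 / 2) * ∑ x, |p.1 x - q.1 x| := rfl

lemma tvDist_nonneg {α : Type} [Fintype α] (p q : FinDist α) : 0 ≤ tvDist p q :=
  mul_nonneg (by norm_num) (Finset.sum_nonneg fun _ _ => abs_nonneg _)

lemma tvDist_le_one {α : Type} [Fintype α] (p q : FinDist α) : tvDist p q ≤ 1 := by
  have : ∑ x, |p.1 x - q.1 x| ≤ 2 := by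
    calc ∑ x, |p.1 x - q.1 x| ≤ ∑ x, (p.1 x + q.1 x) := Finset.sum_le_sum fun x _ => by
          have h1 := p.2.1 x
          have h2 := q.2.1 x
          exact abs_le.2 ⟨by linarith, by linarith⟩
      _ = 2 := by rw [Finset.sum_add_distrib, p.2.2, q.2.2]; norm_num
  rw [tvDist_eq]; linarith

/-- Rounding `N p(x)` down assigns a cell to each distribution, and two members of a cell differ by
at most `1/N` in each coordinate. Choosing a member of each nonempty cell keeps the net inside the
simplex; empty cells get an arbitrary value that is never used. -/
lemma exists_net {k N : ℕ} (hk : 1 ≤ k) (hN : 1 ≤ N) :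
    ∃ rep : (Fin k → Fin (N + 1)) → FinDist (Fin k),
      ∀ p : FinDist (Fin k), ∃ j, ∑ x, |p.1 x - (rep j).1 x| ≤ k / N := by
  classical
  have hN0 : (0 : ℝ) < N := by exact_mod_cast hN
  have hle : ∀ (p : FinDist (Fin k)) x, ⌊N * p.1 x⌋₊ < N + 1 := fun p x => by
    have h1 : p.1 x ≤ 1 := by
      rw [← p.2.2]; exact Finset.single_le_sum (fun i _ => p.2.1 i) (Finset.mem_univ x)
    refine Nat.lt_succ_of_le (Nat.floor_le_of_le ?_)
    nlinarith
  set cell : FinDist (Fin k) → Fin k → Fin (N + 1) := fun p x => ⟨⌊N * p.1 x⌋₊, hle p x⟩ with hc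
  have p0 : FinDist (Fin k) := ⟨_, single_mem_stdSimplex ℝ (⟨0, hk⟩ : Fin k)⟩
  refine ⟨fun j => if h : ∃ p, cell p = j then h.choose else p0, fun p => ⟨cell p, ?_⟩⟩
  have hex : ∃ q, cell q = cell p := ⟨p, rfl⟩
  simp only [dif_pos hex]
  have hq := hex.choose_spec
  set q := hex.choose
  calc ∑ x, |p.1 x - q.1 x| ≤ ∑ _x : Fin k, 1 / (N : ℝ) := by
        refine Finset.sum_le_sum fun x _ => ?_
        have h0 : ⌊N * q.1 x⌋₊ = ⌊N * p.1 x⌋₊ := by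
          have := congrArg Fin.val (congrFun hq x)
          simpa [hc] using this
        have hp1 := Nat.floor_le (mul_nonneg hN0.le (p.2.1 x))
        have hp2 := Nat.lt_floor_add_one (N * p.1 x)
        have hq1 := Nat.floor_le (mul_nonneg hN0.le (q.2.1 x))
        have hq2 := Nat.lt_floor_add_one (N * q.1 x)
        rw [h0] at hq1 hq2
        rw [le_div_iff₀ hN0]; nth_rewrite 1 [← abs_of_pos hN0]; rw [← abs_mul]
        exact abs_le.2 ⟨by linarith, by linarith⟩
    _ = k / N := by
        rw [Finset.sum_const, Finset.card_univ, Fintype.card_fin, nsmul_eq_mul]; ring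

section Estimator

variable {k n : ℕ} {Y J : Type} [DecidableEq Y]

/-- The tests comparing pairs of elements of the net `rep`. -/
def netTest (h : Fin n → Fin k → Y) (rep : J → FinDist (Fin k)) (v : J × J) (i : Fin n) (y : Y) :
    ℝ := hashSign (h i) ((rep v.1).1 - (rep v.2).1) y

/-- The law of the hashed samples. -/
def hashLaw (h : Fin n → Fin k → Y) (p : FinDist (Fin k)) (i : Fin n) (y : Y) : ℝ :=
  hashMass (h i) p.1 y

lemma abs_netTest_le (h : Fin n → Fin k → Y) (rep : J → FinDist (Fin k)) (v : J × J) (i : Fin n)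
    (y : Y) : |netTest h rep v i y| ≤ 1 := (abs_hashSign _ _ _).le

variable [Fintype Y] [Fintype J] [Nonempty J]

/-- A net point whose expected test values are closest to the empirical ones. -/
def minDistIndex (h : Fin n → Fin k → Y) (rep : J → FinDist (Fin k)) (z : Fin n → Y) : J :=
  (Finite.exists_min fun j => maxDev (hashLaw h (rep j)) (netTest h rep) z).choose

lemma maxDev_minDistIndex_le (h : Fin n → Fin k → Y) (rep : J → FinDist (Fin k)) (z : Fin n → Y)
    (j : J) : maxDev (hashLaw h (rep (minDistIndex h rep z))) (netTest h rep) z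
      ≤ maxDev (hashLaw h (rep j)) (netTest h rep) z :=
  (Finite.exists_min fun j => maxDev (hashLaw h (rep j)) (netTest h rep) z).choose_spec j

/-- The net point `j` near `p` fits `z` up to `E`, hence so does the minimizer `l`. Their
predictions for the test of the pair `(l, j)` are therefore within `2E` of each other, and since
that test is the sign of the hashed difference, the gap between the predictions is exactly the sum
of its hashed norms. The separation `hsep` turns this into an `ℓ¹` bound. -/
lemma tvDist_minDist_le {h : Fin n → Fin k → Y} {rep : J → FinDist (Fin k)} {c δ b : ℝ}
    (hc : 0 < c)
    (hsep : ∀ j j', c * ∑ x, |((rep j).1 - (rep j').1) x|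
      ≤ ∑ i, hashNorm (h i) ((rep j).1 - (rep j').1))
    {p : FinDist (Fin k)} (hnet : ∃ j, ∑ x, |p.1 x - (rep j).1 x| ≤ δ)
    {y z : Fin n → Y} (hyz : ∃ C : Finset (Fin n), (C.card : ℝ) ≤ b ∧ ∀ i, i ∉ C → z i = y i) :
    tvDist (rep (minDistIndex h rep z)) p
      ≤ δ / 2 + (2 * b + n * δ + maxDev (hashLaw h p) (netTest h rep) y) / c := by
  obtain ⟨j, hj⟩ := hnet
  obtain ⟨C, hC, hCz⟩ := hyz
  set D := maxDev (hashLaw h p) (netTest h rep) y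
  set E := 2 * b + n * δ + D with hE
  set l := minDistIndex h rep z
  have hstar : maxDev (hashLaw h (rep j)) (netTest h rep) z ≤ E := by
    refine maxDev_le fun v => ?_
    have h1 : |∑ i, netTest h rep v i (z i) - ∑ i, netTest h rep v i (y i)| ≤ 2 * b := by
      rw [← Finset.sum_sub_distrib]
      calc |∑ i, (netTest h rep v i (z i) - netTest h rep v i (y i))|
          ≤ ∑ i, |netTest h rep v i (z i) - netTest h rep v i (y i)| :=
            Finset.abs_sum_le_sum_abs _ _
        _ ≤ ∑ i, if i ∈ C then 2 else 0 := by
            refine Finset.sum_le_sum fun i _ => ?_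
            split_ifs with hi
            · have h1 := abs_le.1 (abs_netTest_le h rep v i (z i))
              have h2 := abs_le.1 (abs_netTest_le h rep v i (y i))
              exact abs_le.2 ⟨by linarith, by linarith⟩
            · rw [hCz i hi]; simp
        _ = 2 * C.card := by simp [Finset.sum_ite_mem, mul_comm]
        _ ≤ 2 * b := by linarith
    have h2 : |∑ i, ∑ a, hashLaw h p i a * netTest h rep v i a
        - ∑ i, ∑ a, hashLaw h (rep j) i a * netTest h rep v i a| ≤ n * δ := by
      rw [← Finset.sum_sub_distrib]
      calc _ ≤ ∑ i : Fin n, |∑ a, hashLaw h p i a * netTest h rep v i a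
              - ∑ a, hashLaw h (rep j) i a * netTest h rep v i a| :=
            Finset.abs_sum_le_sum_abs _ _
        _ ≤ ∑ _i : Fin n, δ := by
            refine Finset.sum_le_sum fun i _ => ?_
            rw [← Finset.sum_sub_distrib]
            have := abs_sum_hashMass_mul_le (h i) (p.1 - (rep j).1)
              (f := netTest h rep v i) (abs_netTest_le h rep v i)
            simp only [hashMass_sub, sub_mul, Pi.sub_apply] at this
            exact this.trans hj
        _ = n * δ := by simp
    have h3 := le_maxDev (hashLaw h p) (netTest h rep) y v
    have h1' := abs_le.1 h1
    have h2' := abs_le.1 h2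
    have h3' := abs_le.1 h3
    exact abs_le.2 ⟨by linarith, by linarith⟩
  have hl := (maxDev_minDistIndex_le h rep z j).trans hstar
  have h4 := abs_le.1 ((le_maxDev _ _ z (l, j)).trans hstar)
  have h5 := abs_le.1 ((le_maxDev _ _ z (l, j)).trans hl)
  have h6 : ∑ i, hashNorm (h i) ((rep l).1 - (rep j).1) ≤ 2 * E := by
    have : ∑ i, hashNorm (h i) ((rep l).1 - (rep j).1)
        = ∑ i, ∑ a, hashLaw h (rep l) i a * netTest h rep (l, j) i a
          - ∑ i, ∑ a, hashLaw h (rep j) i a * netTest h rep (l, j) i a := by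
      rw [← Finset.sum_sub_distrib]
      refine Finset.sum_congr rfl fun i _ => ?_
      rw [← Finset.sum_sub_distrib]
      refine Finset.sum_congr rfl fun a _ => ?_
      rw [← sub_mul, ← hashMass_mul_hashSign, hashMass_sub]
      rfl
    linarith
  have h7 : ∑ x, |((rep l).1 - (rep j).1) x| ≤ 2 * E / c := by
    rw [le_div_iff₀ hc]; linarith [hsep l j]
  have h8 : ∑ x, |(rep l).1 x - p.1 x| ≤ 2 * E / c + δ := by
    calc ∑ x, |(rep l).1 x - p.1 x|
        ≤ ∑ x, (|((rep l).1 - (rep j).1) x| + |p.1 x - (rep j).1 x|) := by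
          refine Finset.sum_le_sum fun x _ => ?_
          have := abs_sub ((rep l).1 x - (rep j).1 x) (p.1 x - (rep j).1 x)
          simpa using this
      _ ≤ _ := by rw [Finset.sum_add_distrib]; linarith
  rw [tvDist_eq]
  have : 2 * E / c = 2 * (E / c) := by ring
  linarith

end Estimator

/-! ### The upper bound -/

section UpperBound

variable {k n ℓ : ℕ}

/-- The scheme in which user `i` sends the hash `h i x` of its sample `x`. -/
def hashScheme (h : Fin n → Fin k → (Fin ℓ → Bool))
    (est : (Fin n → (Fin ℓ → Bool)) → FinDist (Fin k)) : Scheme k n (commChannels k ℓ) where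
  Ω := Unit
  mΩ := ⊤
  μ := Measure.dirac ()
  isProb := Measure.dirac.isProbabilityMeasure
  channel _ i x := ⟨_, single_mem_stdSimplex ℝ (h i x)⟩
  channel_mem _ _ := Set.mem_univ _
  measurable_channel _ _ _ := measurable_const
  estimator _ := est
  measurable_estimator _ _ := measurable_const

lemma hashScheme_messageProb (h : Fin n → Fin k → (Fin ℓ → Bool))
    (est : (Fin n → (Fin ℓ → Bool)) → FinDist (Fin k)) (p : FinDist (Fin k)) (ω : Unit)
    (y : Fin n → (Fin ℓ → Bool)) :
    (hashScheme h est).messageProb p ω y = ∏ i, hashLaw h p i (y i) := by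
  refine Finset.prod_congr rfl fun i _ => ?_
  simp only [hashLaw, hashMass, Finset.sum_filter]
  refine Finset.sum_congr rfl fun x _ => ?_
  simp [hashScheme, Pi.single_apply, eq_comm]

lemma hashScheme_expectedLoss (h : Fin n → Fin k → (Fin ℓ → Bool))
    (est : (Fin n → (Fin ℓ → Bool)) → FinDist (Fin k)) {γ : ℝ} (M : Attack (hashScheme h est) γ)
    (p : FinDist (Fin k)) :
    (hashScheme h est).expectedLoss M p = ENNReal.ofReal
      (∑ y, (∏ i, hashLaw h p i (y i)) * tvDist (est (M.map () y)) p) := by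
  let _ : MeasurableSpace Unit := ⊤
  refine (lintegral_dirac (α := Unit) () fun ω => ENNReal.ofReal
    (∑ y, (hashScheme h est).messageProb p ω y * tvDist (est (M.map ω y)) p)).trans ?_
  exact congrArg ENNReal.ofReal (Finset.sum_congr rfl fun y _ => by rw [hashScheme_messageProb])

lemma card_fiber_mod_le {B : ℕ} (hB : 0 < B) (b : Fin B) :
    (({x | (⟨x.1 % B, Nat.mod_lt _ hB⟩ : Fin B) = b} : Finset (Fin k)).card : ℝ) ≤ k / B + 1 := by
  have h1 : ({x | (⟨x.1 % B, Nat.mod_lt _ hB⟩ : Fin B) = b} : Finset (Fin k)).card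
      ≤ k / B + 1 := by
    rw [← Finset.card_range (k / B + 1)]
    refine Finset.card_le_card_of_injOn (fun x => x.1 / B) (fun x _ => ?_) fun x hx y hy hxy => ?_
    · simp only [Finset.coe_range, Set.mem_Iio]
      exact Nat.lt_succ_of_le (Nat.div_le_div_right x.2.le)
    · simp only [Finset.coe_filter, Finset.mem_univ, true_and, Set.mem_ofPred_eq] at hx hy
      have h2 : x.1 % B = y.1 % B := congrArg Fin.val (hx.trans hy.symm)
      refine Fin.ext ?_
      rw [← Nat.div_add_mod x.1 B, ← Nat.div_add_mod y.1 B, h2]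
      simp only at hxy
      rw [hxy]
  have h2 : (((k / B : ℕ) : ℝ)) ≤ k / B := Nat.cast_div_le
  have h3 : (({x | (⟨x.1 % B, Nat.mod_lt _ hB⟩ : Fin B) = b} : Finset (Fin k)).card : ℝ)
      ≤ ((k / B + 1 : ℕ) : ℝ) := by exact_mod_cast h1
  push_cast at h3
  linarith

/-- The sign bit halves the number of buckets, which accounts for a factor `2`; the rounding `+ 1`
is absorbed because the ratio on the right is at least `1`. -/
lemma card_fiber_bound (hℓ : 1 ≤ ℓ) (hk : 2 ≤ k) :
    (k : ℝ) / ((2 ^ (ℓ - 1) : ℕ) : ℝ) + 1 ≤ 3 * (k / min ((2 : ℝ) ^ ℓ) (k : ℝ)) := by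
  have hk0 : (0 : ℝ) < k := by positivity
  have e : (2 : ℝ) ^ ℓ = 2 * 2 ^ (ℓ - 1) := by
    rw [← pow_succ']; congr 1; omega
  rw [e]
  push_cast
  have hB : (0 : ℝ) < 2 ^ (ℓ - 1) := by positivity
  generalize (2 : ℝ) ^ (ℓ - 1) = B at hB
  rcases le_total (2 * B) k with h | h
  · rw [min_eq_left h]
    have : 1 ≤ k / (2 * B) := by rwa [one_le_div (by positivity)]
    have h2 : k / B = 2 * (k / (2 * B)) := by field_simp
    linarith
  · rw [min_eq_right h, div_self hk0.ne']
    have : k / B ≤ 2 := by rw [div_le_iff₀ hB]; exact h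
    linarith

lemma log_card_net_le (hk : 2 ≤ k) (hn : 1 ≤ n) :
    Real.log (2 * Fintype.card ((Fin k → Fin (k * n + 1)) × (Fin k → Fin (k * n + 1))))
      ≤ 5 * k * Real.log (k * n) := by
  have hkn : (2 : ℝ) ≤ (k : ℝ) * n := by
    have : 2 ≤ k * n := by nlinarith
    exact_mod_cast this
  have hk' : (2 : ℝ) ≤ k := by exact_mod_cast hk
  simp only [Fintype.card_prod, Fintype.card_fun, Fintype.card_fin]
  push_cast
  have hpos : (0 : ℝ) < (k : ℝ) * n + 1 := by linarith
  rw [Real.log_mul (by norm_num) (by positivity), Real.log_mul (by positivity) (by positivity),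
    Real.log_pow]
  have h1 : Real.log (k * n + 1) ≤ 2 * Real.log (k * n) := by
    have : Real.log (k * n + 1) ≤ Real.log ((k * n) ^ 2) :=
      Real.log_le_log hpos (by nlinarith)
    rwa [Real.log_pow] at this
  have h2 : Real.log 2 ≤ Real.log (k * n) := Real.log_le_log (by norm_num) hkn
  have h3 : 0 < Real.log 2 := Real.log_pos (by norm_num)
  have h4 : (k : ℝ) * Real.log (k * n + 1) ≤ k * (2 * Real.log (k * n)) := by gcongr
  nlinarith

/-- The error of the hashing scheme, in terms of the rate. -/
lemma hashing_error_le {K N L γ Λ t : ℝ} (hN : 1 ≤ N) (hL : 0 < L) (hLK : L ≤ K) (hγ : 0 ≤ γ)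
    (hK : 1 ≤ K)
    (hΛ : 1 / 2 ≤ Λ) (ht : t ≤ 5 * K * Λ) {x : ℝ} (hx1 : x ≤ 1)
    (hx : 0 < N / (2 * √(3 * (K / L))) - √(8 * N * t) →
      x ≤ 1 / N / 2 + (2 * (γ * N) + N * (1 / N) + √(8 * N * t))
        / (N / (2 * √(3 * (K / L))) - √(8 * N * t))) :
    x ≤ 130 * Λ * (√(K ^ 2 / (N * L)) + γ * √(K / L)) := by
  have hN0 : 0 < N := by linarith
  have hK0 : 0 < K := by linarith
  set a := √(K / L) with ha
  have ha1 : 1 ≤ a := by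
    rw [ha, Real.one_le_sqrt, one_le_div hL]; exact hLK
  have hm : √(3 * (K / L)) ≤ 2 * a := by
    rw [Real.sqrt_mul (by norm_num)]
    have : √3 ≤ 2 := by rw [Real.sqrt_le_left (by norm_num)]; norm_num
    gcongr
  have hm0 : 0 < √(3 * (K / L)) := Real.sqrt_pos.2 (by positivity)
  set b := √(K / N) with hb
  have hs : √(K ^ 2 / (N * L)) = a * b := by
    rw [ha, hb, ← Real.sqrt_mul (by positivity)]; congr 1; field_simp
  rw [hs]
  have hb0 : 0 < b := Real.sqrt_pos.2 (by positivity)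
  have hbN : 1 / N ≤ b := by
    refine Real.le_sqrt_of_sq_le ?_
    rw [div_pow, one_pow, div_le_div_iff₀ (by positivity) hN0]
    nlinarith
  -- `Λ ≥ 1/2` gives `Λ ≤ 2Λ²`, so `√Λ` may be replaced by a multiple of `Λ`; `14² = 196` leaves
  -- slack over `80`.
  have hT : √(8 * N * t) ≤ N * (14 * Λ * b) := by
    refine Real.sqrt_le_iff.2 ⟨by positivity, ?_⟩
    have hb2 : b ^ 2 = K / N := Real.sq_sqrt (by positivity)
    calc 8 * N * t ≤ 8 * N * (5 * K * Λ) := by gcongr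
      _ = 40 * (N * K) * Λ := by ring
      _ ≤ 40 * (N * K) * (Λ * (2 * Λ)) := by
          gcongr; nlinarith
      _ ≤ 196 * (N * K) * Λ ^ 2 := by
          have : 0 ≤ N * K * Λ ^ 2 := by positivity
          nlinarith
      _ = (N * (14 * Λ * b)) ^ 2 := by
          rw [mul_pow, mul_pow, hb2]; field_simp; norm_num
  set T := √(8 * N * t) with hTdef
  have hT0 : 0 ≤ T := Real.sqrt_nonneg _
  have hab : 0 < a * b := by positivity
  have hγa : 0 ≤ γ * a := by positivity
  have hc4 : N / (8 * a) ≤ N / (2 * √(3 * (K / L))) / 2 := by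
    rw [div_div]
    refine div_le_div_of_nonneg_left hN0.le (by positivity) ?_
    linarith
  -- Either the fluctuation `T` is at most half of the main separation term, so that `c ≥ N/(8a)`,
  -- or `112 Λ a b > 1` and the claim follows from `x ≤ 1`.
  rcases le_or_gt T (N / (8 * a)) with h | h
  · set c := N / (2 * √(3 * (K / L))) - T with hc
    have hcge : N / (8 * a) ≤ c := by rw [hc]; linarith
    have hc0 : 0 < N / (8 * a) := by positivity
    have h1 := hx (lt_of_lt_of_le hc0 hcge)
    have h2 : (2 * (γ * N) + N * (1 / N) + T) / c
        ≤ (2 * (γ * N) + N * b + N * (14 * Λ * b)) / (N / (8 * a)) := by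
      gcongr
    have h3 : (2 * (γ * N) + N * b + N * (14 * Λ * b)) / (N / (8 * a))
        = 16 * (γ * a) + 8 * (a * b) + 112 * Λ * (a * b) := by
      field_simp; ring
    have h4 : 1 / N / 2 ≤ a * b / 2 := by
      have : b ≤ a * b := le_mul_of_one_le_left hb0.le ha1
      linarith
    nlinarith [mul_le_mul_of_nonneg_right hΛ hab.le, mul_le_mul_of_nonneg_right hΛ hγa]
  · have h1 : N / (8 * a) < N * (14 * Λ * b) := lt_of_lt_of_le h hT
    rw [div_lt_iff₀ (by positivity)] at h1
    have h2 : 1 < 14 * Λ * b * (8 * a) := by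
      by_contra! hcon
      nlinarith
    nlinarith [mul_nonneg (by linarith : (0 : ℝ) ≤ Λ) hγa, mul_pos (by linarith : (0 : ℝ) < Λ) hab]

lemma riskDL_le {γ : ℝ} (hk : 2 ≤ k) (hn : 1 ≤ n) (hℓ : 1 ≤ ℓ) (hγ : 0 ≤ γ) :
    riskDL k n (commChannels k ℓ) γ
      ≤ ENNReal.ofReal (130 * Real.log ((k : ℝ) * n) ^ 1 * lbitRate k n ℓ γ) := by
  have hnne : Nonempty (Fin n) := ⟨⟨0, hn⟩⟩
  have hk0 : (0 : ℝ) < k := by positivity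
  have hk1 : (1 : ℝ) ≤ k := by exact_mod_cast (by omega : 1 ≤ k)
  have hn1 : (1 : ℝ) ≤ n := by exact_mod_cast hn
  have hkn : (2 : ℝ) ≤ (k : ℝ) * n := by
    have : 2 ≤ k * n := by nlinarith
    exact_mod_cast this
  have hΛ : 1 / 2 ≤ Real.log (k * n) := by
    have := Real.log_two_gt_d9
    have := Real.log_le_log (by norm_num) hkn
    linarith
  have hL0 : 0 < min ((2 : ℝ) ^ ℓ) (k : ℝ) := lt_min (by positivity) hk0
  -- Resolution `k n` gives the net radius `1/n`, which shifts a sum of `n` tests by at most `1`.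
  obtain ⟨rep, hrep⟩ := exists_net (k := k) (N := k * n) (by omega) (by nlinarith)
  have hrep' : ∀ p : FinDist (Fin k), ∃ j, ∑ x, |p.1 x - (rep j).1 x| ≤ 1 / (n : ℝ) := by
    intro p
    obtain ⟨j, hj⟩ := hrep p
    refine ⟨j, hj.trans_eq ?_⟩
    push_cast
    field_simp
  have hB : 0 < 2 ^ (ℓ - 1) := by positivity
  obtain ⟨φ⟩ : Nonempty (Fin (2 ^ (ℓ - 1)) × Bool ↪ (Fin ℓ → Bool)) := by
    rw [Function.Embedding.nonempty_iff_card_le]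
    simp only [Fintype.card_prod, Fintype.card_fin, Fintype.card_bool, Fintype.card_fun]
    rw [← pow_succ]
    exact Nat.pow_le_pow_right (by norm_num) (by omega)
  obtain ⟨h, hh⟩ := exists_hashes φ.injective
    (fun x : Fin k => (⟨x.1 % 2 ^ (ℓ - 1), Nat.mod_lt _ hB⟩ : Fin (2 ^ (ℓ - 1))))
    (m := 3 * (k / min ((2 : ℝ) ^ ℓ) (k : ℝ))) (by positivity)
    (fun b => (card_fiber_mod_le hB b).trans (card_fiber_bound hℓ hk))
    (fun v : (Fin k → Fin (k * n + 1)) × (Fin k → Fin (k * n + 1)) => (rep v.1).1 - (rep v.2).1) hn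
  refine iInf_le_of_le (hashScheme h fun z => rep (minDistIndex h rep z))
    (iSup₂_le fun p M => ?_)
  rw [hashScheme_expectedLoss]
  refine ENNReal.ofReal_le_ofReal ?_
  have hw0 : ∀ i y, 0 ≤ hashLaw h p i y := fun i y => hashMass_nonneg _ p.2.1 y
  have hw : ∀ i, ∑ y, hashLaw h p i y = 1 := fun i => (sum_hashMass _ _).trans p.2.2
  have hP0 : ∀ y : Fin n → (Fin ℓ → Bool), 0 ≤ ∏ i, hashLaw h p i (y i) :=
    fun y => Finset.prod_nonneg fun i _ => hw0 i _
  have hP1 : ∑ y : Fin n → (Fin ℓ → Bool), ∏ i, hashLaw h p i (y i) = 1 :=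
    sum_prod_weights_eq_one hw
  set x := ∑ y, (∏ i, hashLaw h p i (y i)) * tvDist (rep (minDistIndex h rep (M.map () y))) p
  have hx1 : x ≤ 1 := by
    rw [← hP1]
    exact Finset.sum_le_sum fun y _ => mul_le_of_le_one_right (hP0 y) (tvDist_le_one _ _)
  have hmain := hashing_error_le hn1 hL0 (min_le_right _ _) hγ hk1 hΛ (log_card_net_le hk hn) hx1
    (by
      intro hc
      set T := √(8 * (n : ℝ) * Real.log (2 * Fintype.card ((Fin k → Fin (k * n + 1))
        × (Fin k → Fin (k * n + 1))))) with hT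
      set c := (n : ℝ) / (2 * √(3 * (k / min ((2 : ℝ) ^ ℓ) (k : ℝ)))) - T with hcdef
      have hdev : ∑ y : Fin n → (Fin ℓ → Bool), (∏ i, hashLaw h p i (y i))
          * maxDev (hashLaw h p) (netTest h rep) y ≤ T := by
        have := sum_prod_mul_maxDev_le' hw0 hw (f := netTest h rep) (abs_netTest_le h rep)
        rwa [Fintype.card_fin] at this
      calc x ≤ ∑ y : Fin n → (Fin ℓ → Bool), (∏ i, hashLaw h p i (y i))
            * (1 / (n : ℝ) / 2 + (2 * (γ * n) + n * (1 / (n : ℝ))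
              + maxDev (hashLaw h p) (netTest h rep) y) / c) :=
            Finset.sum_le_sum fun y _ => mul_le_mul_of_nonneg_left
              (tvDist_minDist_le hc (fun j j' => hh (j, j')) (hrep' p) (M.budget () y)) (hP0 y)
        _ = (1 / (n : ℝ) / 2 + (2 * (γ * n) + n * (1 / (n : ℝ))) / c)
              * ∑ y : Fin n → (Fin ℓ → Bool), ∏ i, hashLaw h p i (y i)
            + (∑ y : Fin n → (Fin ℓ → Bool), (∏ i, hashLaw h p i (y i))
              * maxDev (hashLaw h p) (netTest h rep) y) / c := by
            rw [Finset.mul_sum, Finset.sum_div, ← Finset.sum_add_distrib]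
            exact Finset.sum_congr rfl fun y _ => by ring
        _ ≤ (1 / (n : ℝ) / 2 + (2 * (γ * n) + n * (1 / (n : ℝ))) / c) * 1 + T / c := by
            rw [hP1]; gcongr
        _ = _ := by ring)
  rw [lbitRate, pow_one]
  rcases min_cases 1 (√((k : ℝ) ^ 2 / ((n : ℝ) * min ((2 : ℝ) ^ ℓ) (k : ℝ)))
    + γ * √((k : ℝ) / min ((2 : ℝ) ^ ℓ) (k : ℝ))) with ⟨h1, -⟩ | ⟨h1, -⟩ <;> rw [h1]
  · linarith
  · exact hmain

end UpperBound

/-! ### Bayes lower bounds on the risk -/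

section Bayes

/-- Choosing measurably among finitely many measurable functions gives a measurable function. -/
lemma measurable_finite_select {Ω β : Type} [MeasurableSpace Ω] [Fintype β] {sel : Ω → β}
    (hsel : ∀ b, MeasurableSet {ω | sel ω = b}) {g : β → Ω → ℝ} (hg : ∀ b, Measurable (g b)) :
    Measurable fun ω => g (sel ω) ω := by
  classical
  have : (fun ω => g (sel ω) ω) = fun ω => ∑ b, if sel ω = b then g b ω else 0 := by
    funext ω; simp
  rw [this]
  exact Finset.measurable_sum _ fun b _ => Measurable.ite (hsel b) (hg b) measurable_const

/-- An attack has to depend measurably on the public randomness, so the maximizer is built by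
finitely many measurable comparisons. -/
lemma exists_measurable_argmax {Ω β : Type} [MeasurableSpace Ω] [Fintype β] {B : Finset β}
    (hB : B.Nonempty) {g : β → Ω → ℝ} (hg : ∀ b, Measurable (g b)) :
    ∃ sel : Ω → β, (∀ ω, sel ω ∈ B) ∧ (∀ ω, ∀ b ∈ B, g b ω ≤ g (sel ω) ω) ∧
      ∀ b, MeasurableSet {ω | sel ω = b} := by
  classical
  induction hB using Finset.Nonempty.cons_induction with
  | singleton a => exact ⟨fun _ => a, by simp, by simp, fun b => MeasurableSet.const _⟩
  | cons a B ha hB ih =>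
    obtain ⟨sel, h1, h2, h3⟩ := ih
    have hm : MeasurableSet {ω | g (sel ω) ω ≤ g a ω} :=
      measurableSet_le (measurable_finite_select h3 hg) (hg a)
    refine ⟨fun ω => if g (sel ω) ω ≤ g a ω then a else sel ω, fun ω => ?_, fun ω b hb => ?_,
      fun b => ?_⟩
    · beta_reduce
      split_ifs
      · simp
      · simp [h1 ω]
    · rw [Finset.mem_cons] at hb
      beta_reduce
      split_ifs with h
      · rcases hb with rfl | hb
        · exact le_rfl
        · exact (h2 ω b hb).trans h
      · rcases hb with rfl | hb
        · exact (not_le.1 h).le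
        · exact h2 ω b hb
    · have : {ω | (if g (sel ω) ω ≤ g a ω then a else sel ω) = b}
          = ({ω | g (sel ω) ω ≤ g a ω} ∩ {_ω | a = b})
            ∪ ({ω | g (sel ω) ω ≤ g a ω}ᶜ ∩ {ω | sel ω = b}) := by
        ext ω
        by_cases h : g (sel ω) ω ≤ g a ω <;> simp [h]
      rw [this]
      exact (hm.inter (MeasurableSet.const _)).union (hm.compl.inter (h3 b))

variable {k n : ℕ} {Y : Type} [Fintype Y] {𝒲 : Set (Channel k Y)}

/-- The expected loss given the public randomness. -/
def Scheme.pointLoss (S : Scheme k n 𝒲) {γ : ℝ} (M : Attack S γ) (p : FinDist (Fin k)) (ω : S.Ω) :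
    ℝ := ∑ y : Fin n → Y, S.messageProb p ω y * tvDist (S.estimator ω (M.map ω y)) p

lemma Scheme.messageProb_nonneg (S : Scheme k n 𝒲) (p : FinDist (Fin k)) (ω : S.Ω)
    (y : Fin n → Y) : 0 ≤ S.messageProb p ω y :=
  Finset.prod_nonneg fun i _ => Finset.sum_nonneg fun x _ =>
    mul_nonneg (p.2.1 x) ((S.channel ω i x).2.1 _)

lemma Scheme.pointLoss_nonneg (S : Scheme k n 𝒲) {γ : ℝ} (M : Attack S γ) (p : FinDist (Fin k))
    (ω : S.Ω) : 0 ≤ S.pointLoss M p ω :=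
  Finset.sum_nonneg fun y _ => mul_nonneg (S.messageProb_nonneg p ω y) (tvDist_nonneg _ _)

lemma Scheme.measurable_tvDist (S : Scheme k n 𝒲) (p : FinDist (Fin k)) (z : Fin n → Y) :
    Measurable[S.mΩ] fun ω => tvDist (S.estimator ω z) p := by
  let _ := S.mΩ
  simp only [tvDist_eq]
  refine measurable_const.mul (Finset.measurable_sum _ fun x _ => ?_)
  exact _root_.continuous_abs.measurable.comp ((S.measurable_estimator z x).sub measurable_const)

lemma Scheme.measurable_pointLoss (S : Scheme k n 𝒲) {γ : ℝ} (M : Attack S γ)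
    (p : FinDist (Fin k)) : Measurable[S.mΩ] (S.pointLoss M p) := by
  classical
  let _ := S.mΩ
  refine Finset.measurable_sum _ fun y _ => Measurable.mul ?_ ?_
  · refine Finset.measurable_prod _ fun i _ => Finset.measurable_sum _ fun x _ => ?_
    exact measurable_const.mul (S.measurable_channel i x (y i))
  · exact measurable_finite_select (sel := fun ω => M.map ω y) (M.measurable_map y)
      (fun z => S.measurable_tvDist p z)

/-- A lower bound on the average of the conditional losses over a finite family of distributions
and attacks bounds the worst case. -/
lemma Scheme.le_iSup_expectedLoss (S : Scheme k n 𝒲) {γ : ℝ} {Z : Type} [Fintype Z] [Nonempty Z]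
    (p : Z → FinDist (Fin k)) (M : Z → Attack S γ) {b : ℝ}
    (h : ∀ ω, Fintype.card Z * b ≤ ∑ z, S.pointLoss (M z) (p z) ω) :
    ENNReal.ofReal b ≤ ⨆ p : FinDist (Fin k), ⨆ M : Attack S γ, S.expectedLoss M p := by
  let _ := S.mΩ
  have := S.isProb
  have hcard : (Fintype.card Z : ℝ≥0∞) ≠ 0 := by simp
  refine (ENNReal.mul_le_mul_iff_right hcard (ENNReal.natCast_ne_top _)).1 ?_
  calc (Fintype.card Z : ℝ≥0∞) * ENNReal.ofReal b
      = ∫⁻ _ω, ENNReal.ofReal (Fintype.card Z * b) ∂S.μ := by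
        rw [lintegral_const, measure_univ, mul_one, ENNReal.ofReal_mul (by positivity),
          ENNReal.ofReal_natCast]
    _ ≤ ∫⁻ ω, ∑ z, ENNReal.ofReal (S.pointLoss (M z) (p z) ω) ∂S.μ := by
        refine lintegral_mono fun ω => ?_
        rw [← ENNReal.ofReal_sum_of_nonneg fun z _ => S.pointLoss_nonneg _ _ _]
        exact ENNReal.ofReal_le_ofReal (h ω)
    _ = ∑ z, S.expectedLoss (M z) (p z) :=
        lintegral_finsetSum _ fun z _ => (S.measurable_pointLoss _ _).ennreal_ofReal
    _ ≤ ∑ _z : Z, ⨆ p : FinDist (Fin k), ⨆ M : Attack S γ, S.expectedLoss M p :=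
        Finset.sum_le_sum fun z _ =>
          le_iSup₂ (f := fun p (M : Attack S γ) => S.expectedLoss M p) (p z) (M z)
    _ = _ := by rw [Finset.sum_const, Finset.card_univ, nsmul_eq_mul]

/-- The attack that changes nothing. -/
def Attack.id (S : Scheme k n 𝒲) {γ : ℝ} (hγ : 0 ≤ γ) : Attack S γ where
  map _ y := y
  budget _ _ := ⟨∅, by simpa using mul_nonneg hγ (Nat.cast_nonneg n), fun _ _ => rfl⟩
  measurable_map _ _ := @MeasurableSet.const _ S.mΩ _

/-- There is an attack that maximizes the loss for every outcome of the public randomness and all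
intended messages. -/
lemma Scheme.exists_best_attack [DecidableEq Y] (S : Scheme k n 𝒲) {γ : ℝ} (hγ : 0 ≤ γ)
    (p : FinDist (Fin k)) :
    ∃ M : Attack S γ, ∀ ω y z, (hammingDist y z : ℝ) ≤ γ * n →
      tvDist (S.estimator ω z) p ≤ tvDist (S.estimator ω (M.map ω y)) p := by
  classical
  let _ := S.mΩ
  have hex : ∀ y : Fin n → Y, _ := fun y => exists_measurable_argmax
    (B := {z : Fin n → Y | (hammingDist y z : ℝ) ≤ γ * n})
    ⟨y, by simpa using mul_nonneg hγ (Nat.cast_nonneg n)⟩ (fun z => S.measurable_tvDist p z)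
  choose sel h1 h2 h3 using hex
  refine ⟨⟨fun ω y => sel y ω, fun ω y => ⟨({i | y i ≠ sel y ω i} : Finset (Fin n)), ?_, ?_⟩,
    fun y z => h3 y z⟩, fun ω y z hz => ?_⟩
  · have := h1 y ω
    rw [Finset.mem_filter] at this
    exact this.2
  · intro i hi
    simp only [Finset.mem_filter, Finset.mem_univ, true_and, not_not] at hi
    exact hi.symm
  · exact h2 y ω z (by simpa using hz)

end Bayes

/-! ### Couplings and the gain of an attack -/

section Coupling

variable {Y : Type} [Fintype Y] [DecidableEq Y]

/-- The maximal coupling of two distributions on a finite set. -/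
lemma exists_coupling {P Q : Y → ℝ} (hP0 : ∀ y, 0 ≤ P y) (hQ0 : ∀ y, 0 ≤ Q y)
    (hP : ∑ y, P y = 1) (hQ : ∑ y, Q y = 1) :
    ∃ π : Y → Y → ℝ, (∀ y z, 0 ≤ π y z) ∧ (∀ y, ∑ z, π y z = P y) ∧ (∀ z, ∑ y, π y z = Q z) ∧
      ∑ y, ∑ z, (if y ≠ z then π y z else 0) ≤ (1 / 2) * ∑ y, |P y - Q y| := by
  set m : Y → ℝ := fun y => min (P y) (Q y) with hm
  set t : ℝ := 1 - ∑ y, m y with ht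
  have hPm : ∑ y, (P y - m y) = t := by rw [Finset.sum_sub_distrib, hP]
  have hQm : ∑ y, (Q y - m y) = t := by rw [Finset.sum_sub_distrib, hQ]
  have hP0' : ∀ y, 0 ≤ P y - m y := fun y => sub_nonneg.2 (min_le_left _ _)
  have hQ0' : ∀ y, 0 ≤ Q y - m y := fun y => sub_nonneg.2 (min_le_right _ _)
  have hm0 : ∀ y, 0 ≤ m y := fun y => le_min (hP0 y) (hQ0 y)
  have ht0 : 0 ≤ t := hPm ▸ Finset.sum_nonneg fun y _ => hP0' y
  -- If `t = 0` the quotient is `0` by convention, which is right because then `P = m`.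
  have hPt : ∀ y, (P y - m y) * t / t = P y - m y := fun y => by
    rcases ht0.eq_or_lt with h | h
    · have h1 : P y - m y ≤ t := hPm ▸ Finset.single_le_sum (fun y _ => hP0' y) (Finset.mem_univ y)
      rw [← h, le_antisymm (h ▸ h1) (hP0' y)]; simp
    · field_simp
  have hQt : ∀ y, t * (Q y - m y) / t = Q y - m y := fun y => by
    rcases ht0.eq_or_lt with h | h
    · have h1 : Q y - m y ≤ t := hQm ▸ Finset.single_le_sum (fun y _ => hQ0' y) (Finset.mem_univ y)
      rw [← h, le_antisymm (h ▸ h1) (hQ0' y)]; simp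
    · field_simp
  have hnn : ∀ y z, 0 ≤ (P y - m y) * (Q z - m z) / t :=
    fun y z => div_nonneg (mul_nonneg (hP0' y) (hQ0' z)) ht0
  have htv : (1 / 2) * ∑ y, |P y - Q y| = t := by
    have : ∑ y, |P y - Q y| = ∑ y, ((P y - m y) + (Q y - m y)) := by
      refine Finset.sum_congr rfl fun y _ => ?_
      simp only [hm]
      rcases le_total (P y) (Q y) with h | h
      · rw [min_eq_left h, abs_of_nonpos (by linarith)]; ring
      · rw [min_eq_right h, abs_of_nonneg (by linarith)]; ring
    rw [this, Finset.sum_add_distrib, hPm, hQm]; ring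
  -- The common mass `min(P, Q)` stays on the diagonal; the excesses of `P` and of `Q`, both of
  -- total mass `t`, are coupled independently.
  refine ⟨fun y z => (if y = z then m y else 0) + (P y - m y) * (Q z - m z) / t,
    fun y z => add_nonneg (by split_ifs; exacts [hm0 y, le_rfl]) (hnn y z),
    fun y => ?_, fun z => ?_, ?_⟩
  · rw [Finset.sum_add_distrib, ← Finset.sum_div, ← Finset.mul_sum, hQm, hPt]; simp
  · rw [Finset.sum_add_distrib, ← Finset.sum_div, ← Finset.sum_mul, hPm, hQt]; simp
  · rw [htv]
    calc _ ≤ ∑ y, ∑ z, (P y - m y) * (Q z - m z) / t := by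
          refine Finset.sum_le_sum fun y _ => Finset.sum_le_sum fun z _ => ?_
          by_cases h : y = z
          · simpa [h] using hnn z z
          · simp [h]
      _ = t := by
          simp only [← Finset.sum_div, ← Finset.mul_sum, hQm, hPt, hPm]

variable {ι : Type} [Fintype ι] [DecidableEq ι]

/-- Marginalization of a product weight to one coordinate. -/
lemma sum_prod_mul_coord {α : Type} [Fintype α] {w : ι → α → ℝ} (hw : ∀ i, ∑ a, w i a = 1)
    (j : ι) (f : α → ℝ) :
    ∑ a : ι → α, (∏ i, w i (a i)) * f (a j) = ∑ b, w j b * f b := by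
  calc ∑ a : ι → α, (∏ i, w i (a i)) * f (a j)
      = ∑ a : ι → α, ∏ i, (w i (a i) * if i = j then f (a i) else 1) := by
        refine Finset.sum_congr rfl fun a _ => ?_
        rw [Finset.prod_mul_distrib]; simp
    _ = ∏ i, ∑ b, w i b * (if i = j then f b else 1) :=
        (Fintype.prod_sum fun i b => w i b * (if i = j then f b else 1)).symm
    _ = ∏ i, if i = j then ∑ b, w i b * f b else 1 := by
        refine Finset.prod_congr rfl fun i _ => ?_
        split_ifs
        · rfl
        · simp [hw i]
    _ = _ := by simp

/-- An adversary who may change `b` coordinates can, up to the probability that a coupling of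
the true messages with `∏ Q i` differs in more than `b` places, replace the law of the messages
by `∏ Q i`. -/
lemma attack_gain {P Q : ι → Y → ℝ} (hP0 : ∀ i y, 0 ≤ P i y) (hQ0 : ∀ i y, 0 ≤ Q i y)
    (hP : ∀ i, ∑ y, P i y = 1) (hQ : ∀ i, ∑ y, Q i y = 1) {b ε : ℝ} (hb : 0 < b) (hε : 0 ≤ ε)
    {G H : (ι → Y) → ℝ} (hG : ∀ z, G z ≤ ε) (hH : ∀ y, 0 ≤ H y)
    (hGH : ∀ y z, (hammingDist y z : ℝ) ≤ b → G z ≤ H y) :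
    ∑ z, (∏ i, Q i (z i)) * G z - ε * ((1 / 2) * ∑ i, ∑ y, |P i y - Q i y|) / b
      ≤ ∑ y, (∏ i, P i (y i)) * H y := by
  choose π h0 h1 h2 h3 using fun i => exists_coupling (hP0 i) (hQ0 i) (hP i) (hQ i)
  have hprodP : ∀ y : ι → Y, ∏ i, P i (y i) = ∑ z : ι → Y, ∏ i, π i (y i) (z i) := fun y => by
    rw [← Fintype.prod_sum fun i c => π i (y i) c]
    exact Finset.prod_congr rfl fun i _ => (h1 i _).symm
  have hprodQ : ∀ z : ι → Y, ∏ i, Q i (z i) = ∑ y : ι → Y, ∏ i, π i (y i) (z i) := fun z => by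
    rw [← Fintype.prod_sum fun i c => π i c (z i)]
    exact Finset.prod_congr rfl fun i _ => (h2 i _).symm
  have hπ0 : ∀ y z : ι → Y, 0 ≤ ∏ i, π i (y i) (z i) :=
    fun y z => Finset.prod_nonneg fun i _ => h0 i _ _
  have hham : ∑ y : ι → Y, ∑ z : ι → Y, (∏ i, π i (y i) (z i)) * hammingDist y z
      ≤ (1 / 2) * ∑ i, ∑ y, |P i y - Q i y| := by
    have hw : ∀ i, ∑ a : Y × Y, π i a.1 a.2 = 1 := fun i => by
      rw [Fintype.sum_prod_type]; simp only [h1, hP]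
    calc ∑ y : ι → Y, ∑ z : ι → Y, (∏ i, π i (y i) (z i)) * hammingDist y z
        = ∑ a : ι → Y × Y, (∏ i, π i (a i).1 (a i).2)
            * ∑ j, (if (a j).1 ≠ (a j).2 then 1 else 0) := by
          rw [← Fintype.sum_prod_type'
            (f := fun y z : ι → Y => (∏ i, π i (y i) (z i)) * (hammingDist y z : ℝ))]
          refine (Fintype.sum_equiv (Equiv.arrowProdEquivProdArrow ι (fun _ => Y) (fun _ => Y))
            _ _ fun a => ?_).symm
          simp only [hammingDist, Equiv.arrowProdEquivProdArrow, Equiv.coe_fn_mk, Finset.sum_boole]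
          congr!
      _ = ∑ j, ∑ a : ι → Y × Y, (∏ i, π i (a i).1 (a i).2)
            * (if (a j).1 ≠ (a j).2 then 1 else 0) := by
          simp only [Finset.mul_sum]
          rw [Finset.sum_comm]
      _ = ∑ j, ∑ a : Y × Y, π j a.1 a.2 * (if a.1 ≠ a.2 then 1 else 0) :=
          Finset.sum_congr rfl fun j _ => sum_prod_mul_coord (w := fun i (a : Y × Y) => π i a.1 a.2) hw j
            fun a : Y × Y => if a.1 ≠ a.2 then 1 else 0
      _ ≤ ∑ j, (1 / 2) * ∑ y, |P j y - Q j y| := by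
          refine Finset.sum_le_sum fun j _ => ?_
          rw [Fintype.sum_prod_type]
          simpa using h3 j
      _ = _ := by rw [Finset.mul_sum]
  -- Markov's inequality in pointwise form: beyond distance `b` the penalty is at least `ε ≥ G z`,
  -- so `H y ≥ 0` suffices.
  have hpt : ∀ y z, G z - ε / b * hammingDist y z ≤ H y := fun y z => by
    rcases le_or_gt (hammingDist y z : ℝ) b with h | h
    · have : 0 ≤ ε / b * hammingDist y z := by positivity
      linarith [hGH y z h]
    · have : ε ≤ ε / b * hammingDist y z := by
        rw [div_mul_eq_mul_div, le_div_iff₀ hb]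
        exact mul_le_mul_of_nonneg_left h.le hε
      linarith [hG z, hH y]
  calc ∑ z, (∏ i, Q i (z i)) * G z - ε * ((1 / 2) * ∑ i, ∑ y, |P i y - Q i y|) / b
      ≤ ∑ z, (∏ i, Q i (z i)) * G z
          - ε / b * ∑ y : ι → Y, ∑ z : ι → Y, (∏ i, π i (y i) (z i)) * hammingDist y z := by
        rw [mul_div_right_comm]
        gcongr
    _ = ∑ y : ι → Y, ∑ z : ι → Y, (∏ i, π i (y i) (z i)) * (G z - ε / b * hammingDist y z) := by
        have : ∑ z, (∏ i, Q i (z i)) * G z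
            = ∑ y : ι → Y, ∑ z : ι → Y, (∏ i, π i (y i) (z i)) * G z := by
          rw [Finset.sum_comm]
          exact Finset.sum_congr rfl fun z _ => by rw [hprodQ, Finset.sum_mul]
        rw [this, Finset.mul_sum, ← Finset.sum_sub_distrib]
        refine Finset.sum_congr rfl fun y _ => ?_
        rw [Finset.mul_sum, ← Finset.sum_sub_distrib]
        exact Finset.sum_congr rfl fun z _ => by ring
    _ ≤ ∑ y : ι → Y, ∑ z : ι → Y, (∏ i, π i (y i) (z i)) * H y :=
        Finset.sum_le_sum fun y _ => Finset.sum_le_sum fun z _ =>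
          mul_le_mul_of_nonneg_left (hpt y z) (hπ0 y z)
    _ = _ := Finset.sum_congr rfl fun y _ => by rw [hprodP, Finset.sum_mul]

end Coupling

/-! ### The affinity of product distributions -/

section Affinity

lemma one_sub_sum_le_prod {ι : Type} (s : Finset ι) {x : ι → ℝ} (h0 : ∀ i, 0 ≤ x i)
    (h1 : ∀ i, x i ≤ 1) : 1 - ∑ i ∈ s, (1 - x i) ≤ ∏ i ∈ s, x i := by
  classical
  induction s using Finset.induction_on with
  | empty => simp
  | insert a s ha ih =>
    rw [Finset.sum_insert ha, Finset.prod_insert ha]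
    have hp : ∏ i ∈ s, x i ≤ 1 := Finset.prod_le_one (fun i _ => h0 i) fun i _ => h1 i
    nlinarith [h0 a, h1 a]

variable {Y : Type} [Fintype Y]

lemma sum_sqrt_mul_le_one {P Q : Y → ℝ} (hP0 : ∀ y, 0 ≤ P y) (hQ0 : ∀ y, 0 ≤ Q y)
    (hP : ∑ y, P y = 1) (hQ : ∑ y, Q y = 1) : ∑ y, √(P y * Q y) ≤ 1 := by
  calc ∑ y, √(P y * Q y) ≤ ∑ y, (P y + Q y) / 2 := Finset.sum_le_sum fun y _ => by
        have h1 := hP0 y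
        have h2 := hQ0 y
        refine Real.sqrt_le_iff.2 ⟨by positivity, ?_⟩
        nlinarith [sq_nonneg (P y - Q y)]
    _ = 1 := by rw [← Finset.sum_div, Finset.sum_add_distrib, hP, hQ]; norm_num

/-- The summands on the left combine to the harmonic mean `2PQ/(P+Q)`, which is at most the
geometric mean. -/
lemma one_sub_le_sum_sqrt_mul {P Q : Y → ℝ} (hP0 : ∀ y, 0 ≤ P y) (hQ0 : ∀ y, 0 ≤ Q y)
    (hP : ∑ y, P y = 1) (hQ : ∑ y, Q y = 1) :
    1 - (1 / 2) * ∑ y, (P y - Q y) ^ 2 / (P y + Q y) ≤ ∑ y, √(P y * Q y) := by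
  calc 1 - (1 / 2) * ∑ y, (P y - Q y) ^ 2 / (P y + Q y)
      = ∑ y, ((P y + Q y) / 2 - (1 / 2) * ((P y - Q y) ^ 2 / (P y + Q y))) := by
        rw [Finset.sum_sub_distrib, ← Finset.mul_sum, ← Finset.sum_div, Finset.sum_add_distrib,
          hP, hQ]
        norm_num
    _ ≤ _ := Finset.sum_le_sum fun y _ => by
        have h1 := hP0 y
        have h2 := hQ0 y
        rcases (add_nonneg h1 h2).eq_or_lt with h | h
        · rw [← h]; simp
        · refine Real.le_sqrt_of_sq_le ?_
          have e : (P y + Q y) / 2 - (1 / 2) * ((P y - Q y) ^ 2 / (P y + Q y))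
              = 2 * (P y * Q y) / (P y + Q y) := by field_simp; ring
          rw [e, div_pow, div_le_iff₀ (by positivity)]
          have h3 : 0 ≤ P y * Q y := mul_nonneg h1 h2
          nlinarith [mul_nonneg h3 (sq_nonneg (P y - Q y))]

/-- Le Cam's inequality: Cauchy–Schwarz for `PQ = min(P,Q) · max(P,Q)`, together with `∑ max(P,Q) ≤
2`. -/
lemma sum_min_ge {P Q : Y → ℝ} (hP0 : ∀ y, 0 ≤ P y) (hQ0 : ∀ y, 0 ≤ Q y)
    (hP : ∑ y, P y = 1) (hQ : ∑ y, Q y = 1) :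
    (1 / 2) * (∑ y, √(P y * Q y)) ^ 2 ≤ ∑ y, min (P y) (Q y) := by
  have hmin0 : ∀ y, 0 ≤ min (P y) (Q y) := fun y => le_min (hP0 y) (hQ0 y)
  have h1 : (∑ y, √(P y * Q y)) ^ 2 ≤ (∑ y, min (P y) (Q y)) * ∑ y, max (P y) (Q y) := by
    have h := Finset.sum_mul_sq_le_sq_mul_sq Finset.univ
      (fun y => √(min (P y) (Q y))) (fun y => √(max (P y) (Q y)))
    have e1 : ∀ y, √(min (P y) (Q y)) * √(max (P y) (Q y)) = √(P y * Q y) := fun y => by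
      rw [← Real.sqrt_mul (hmin0 y), min_mul_max]
    have e2 : ∀ y, √(min (P y) (Q y)) ^ 2 = min (P y) (Q y) := fun y => Real.sq_sqrt (hmin0 y)
    have e3 : ∀ y, √(max (P y) (Q y)) ^ 2 = max (P y) (Q y) :=
      fun y => Real.sq_sqrt (le_max_of_le_left (hP0 y))
    simpa only [e1, e2, e3] using h
  have h2 : ∑ y, max (P y) (Q y) ≤ 2 := by
    calc ∑ y, max (P y) (Q y) ≤ ∑ y, (P y + Q y) := Finset.sum_le_sum fun y _ =>
          max_le (by linarith [hQ0 y]) (by linarith [hP0 y])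
      _ = 2 := by rw [Finset.sum_add_distrib, hP, hQ]; norm_num
  have h3 : 0 ≤ ∑ y, min (P y) (Q y) := Finset.sum_nonneg fun y _ => hmin0 y
  nlinarith

/-- The overlap of two product distributions, bounded by the sum of the chi-square type distances
of the factors. -/
lemma sum_min_prod_ge {ι : Type} [Fintype ι] [DecidableEq ι] {P Q : ι → Y → ℝ}
    (hP0 : ∀ i y, 0 ≤ P i y) (hQ0 : ∀ i y, 0 ≤ Q i y)
    (hP : ∀ i, ∑ y, P i y = 1) (hQ : ∀ i, ∑ y, Q i y = 1) :
    (1 / 2) * (1 - ∑ i, ∑ y, (P i y - Q i y) ^ 2 / (P i y + Q i y))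
      ≤ ∑ y : ι → Y, min (∏ i, P i (y i)) (∏ i, Q i (y i)) := by
  set X := ∑ i, ∑ y, (P i y - Q i y) ^ 2 / (P i y + Q i y) with hX
  have h1 := sum_min_ge (P := fun y : ι → Y => ∏ i, P i (y i)) (Q := fun y => ∏ i, Q i (y i))
    (fun y => Finset.prod_nonneg fun i _ => hP0 i _)
    (fun y => Finset.prod_nonneg fun i _ => hQ0 i _)
    (sum_prod_weights_eq_one hP) (sum_prod_weights_eq_one hQ)
  have h2 : ∑ y : ι → Y, √((∏ i, P i (y i)) * ∏ i, Q i (y i))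
      = ∏ i, ∑ a, √(P i a * Q i a) := by
    rw [Fintype.prod_sum]
    refine Finset.sum_congr rfl fun y _ => ?_
    rw [← Finset.prod_mul_distrib, Real.sqrt_prod _ fun i _ => mul_nonneg (hP0 i _) (hQ0 i _)]
  rw [h2] at h1
  refine le_trans ?_ h1
  have h3 : 1 - X / 2 ≤ ∏ i, ∑ a, √(P i a * Q i a) := by
    refine le_trans ?_ (one_sub_sum_le_prod Finset.univ
      (fun i => Finset.sum_nonneg fun _ _ => Real.sqrt_nonneg _)
      fun i => sum_sqrt_mul_le_one (hP0 i) (hQ0 i) (hP i) (hQ i))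
    have : ∑ i, (1 - ∑ a, √(P i a * Q i a)) ≤ X / 2 := by
      rw [hX, Finset.sum_div]
      refine Finset.sum_le_sum fun i _ => ?_
      have := one_sub_le_sum_sqrt_mul (hP0 i) (hQ0 i) (hP i) (hQ i)
      linarith
    linarith
  -- In the first case squaring gives `(1 - X/2)² ≥ 1 - X`; in the second the left side is negative.
  rcases le_or_gt 0 (1 - X / 2) with h | h
  · nlinarith [sq_nonneg X]
  · nlinarith [sq_nonneg (∏ i, ∑ a, √(P i a * Q i a))]

end Affinity

/-! ### The hard family of distributions -/

section PairFamily

variable {k d : ℕ}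

/-- The weights of the perturbed uniform distribution on `d` pairs of points. -/
def pairWeight (d : ℕ) (ε : ℝ) (z : Fin d → Bool) (c : Fin d × Bool) : ℝ :=
  (1 + ε * (bitSign c.2 * bitSign (z c.1))) / (2 * d)

lemma abs_bitSign (b : Bool) : |bitSign b| = 1 := by cases b <;> simp [bitSign]

lemma pairWeight_nonneg {ε : ℝ} (h0 : 0 ≤ ε) (h1 : ε ≤ 1) (z : Fin d → Bool) (c : Fin d × Bool) :
    0 ≤ pairWeight d ε z c := by
  refine div_nonneg ?_ (by positivity)
  have : |bitSign c.2 * bitSign (z c.1)| = 1 := by rw [abs_mul, abs_bitSign, abs_bitSign, mul_one]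
  nlinarith [(abs_le.1 this.le).1]

lemma sum_pairWeight_mul (ε : ℝ) (z : Fin d → Bool) (F : Fin d × Bool → ℝ) :
    ∑ c, pairWeight d ε z c * F c = (∑ i, (F (i, true) + F (i, false))
      + ε * ∑ i, bitSign (z i) * (F (i, true) - F (i, false))) / (2 * d) := by
  rw [Fintype.sum_prod_type, Finset.mul_sum, ← Finset.sum_add_distrib, Finset.sum_div]
  refine Finset.sum_congr rfl fun i _ => ?_
  rw [Fintype.sum_bool]
  simp only [pairWeight, bitSign, if_true, Bool.false_eq_true, if_false]
  ring

lemma sum_pairWeight (hd : 1 ≤ d) (ε : ℝ) (z : Fin d → Bool) : ∑ c, pairWeight d ε z c = 1 := by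
  have := sum_pairWeight_mul ε z fun _ => 1
  have hd0 : (0 : ℝ) < d := by exact_mod_cast hd
  simp only [mul_one, sub_self, mul_zero, Finset.sum_const_zero, add_zero, Finset.sum_const,
    Finset.card_univ, Fintype.card_fin, nsmul_eq_mul] at this
  rw [this, div_eq_one_iff_eq (by positivity)]
  ring

/-- The distribution on `[k]` with weights `pairWeight` on the points `e c`. -/
def pairDist (e : Fin d × Bool ↪ Fin k) (hd : 1 ≤ d) {ε : ℝ} (h0 : 0 ≤ ε) (h1 : ε ≤ 1)
    (z : Fin d → Bool) : FinDist (Fin k) :=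
  ⟨fun x => ∑ c, if e c = x then pairWeight d ε z c else 0,
    fun x => Finset.sum_nonneg fun c _ => by
      split_ifs; exacts [pairWeight_nonneg h0 h1 z c, le_rfl],
    by rw [Finset.sum_comm]; simp [sum_pairWeight hd]⟩

variable (e : Fin d × Bool ↪ Fin k) (hd : 1 ≤ d) {ε : ℝ} (h0 : 0 ≤ ε) (h1 : ε ≤ 1)

lemma pairDist_apply (z : Fin d → Bool) (c : Fin d × Bool) :
    (pairDist e hd h0 h1 z).1 (e c) = pairWeight d ε z c := by
  simp [pairDist]

lemma sum_pairDist_mul (z : Fin d → Bool) (F : Fin k → ℝ) :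
    ∑ x, (pairDist e hd h0 h1 z).1 x * F x = ∑ c, pairWeight d ε z c * F (e c) := by
  simp only [pairDist, Finset.sum_mul]
  rw [Finset.sum_comm]
  simp [ite_mul]

/-- The contribution of the pair `i` to the total variation distance. -/
def pairLoss (q : FinDist (Fin k)) (ε : ℝ) (i : Fin d) (s : Bool) : ℝ :=
  (1 / 2) * ∑ b, |q.1 (e (i, b)) - (1 + ε * (bitSign b * bitSign s)) / (2 * d)|

lemma pairLoss_nonneg (q : FinDist (Fin k)) (ε : ℝ) (i : Fin d) (s : Bool) :
    0 ≤ pairLoss e q ε i s :=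
  mul_nonneg (by norm_num) (Finset.sum_nonneg fun _ _ => abs_nonneg _)

lemma sum_pairLoss_le (q : FinDist (Fin k)) (z : Fin d → Bool) :
    ∑ i, pairLoss e q ε i (z i) ≤ tvDist q (pairDist e hd h0 h1 z) := by
  rw [tvDist_eq]
  simp only [pairLoss]
  rw [← Finset.mul_sum]
  refine mul_le_mul_of_nonneg_left ?_ (by norm_num)
  calc ∑ i, ∑ b, |q.1 (e (i, b)) - (1 + ε * (bitSign b * bitSign (z i))) / (2 * d)|
      = ∑ c, |q.1 (e c) - (pairDist e hd h0 h1 z).1 (e c)| := by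
        rw [Fintype.sum_prod_type]
        simp only [pairDist_apply, pairWeight]
    _ = ∑ x ∈ Finset.univ.map e, |q.1 x - (pairDist e hd h0 h1 z).1 x| := by
        rw [Finset.sum_map]
    _ ≤ _ := Finset.sum_le_sum_of_subset_of_nonneg (Finset.subset_univ _)
        fun _ _ _ => abs_nonneg _

/-- The two candidate weights at each point of the pair differ by `ε/d`, so no estimate is close to
both. -/
lemma pairLoss_add_ge (q : FinDist (Fin k)) (h0 : 0 ≤ ε) (i : Fin d) (s : Bool) :
    ε / d ≤ pairLoss e q ε i s + pairLoss e q ε i (!s) := by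
  have hd0 : (0 : ℝ) < d := by exact_mod_cast i.pos
  have key : ∀ b, ε / d ≤ |q.1 (e (i, b)) - (1 + ε * (bitSign b * bitSign s)) / (2 * d)|
      + |q.1 (e (i, b)) - (1 + ε * (bitSign b * bitSign (!s))) / (2 * d)| := fun b => by
    have h := abs_sub (q.1 (e (i, b)) - (1 + ε * (bitSign b * bitSign s)) / (2 * d))
      (q.1 (e (i, b)) - (1 + ε * (bitSign b * bitSign (!s))) / (2 * d))
    refine le_trans (le_of_eq ?_) h
    rw [bitSign_not]
    have : q.1 (e (i, b)) - (1 + ε * (bitSign b * bitSign s)) / (2 * d)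
        - (q.1 (e (i, b)) - (1 + ε * (bitSign b * -bitSign s)) / (2 * d))
        = -(ε / d) * (bitSign b * bitSign s) := by field_simp; ring
    rw [this, abs_mul, abs_mul, abs_bitSign, abs_bitSign, abs_neg, abs_of_nonneg (by positivity)]
    ring
  simp only [pairLoss, Fintype.sum_bool]
  have h1 := key true
  have h2 := key false
  linarith

lemma tvDist_add_ge (q : FinDist (Fin k)) (z : Fin d → Bool) :
    ε ≤ tvDist q (pairDist e hd h0 h1 z) + tvDist q (pairDist e hd h0 h1 fun i => !(z i)) := by
  have hd0 : (0 : ℝ) < d := by exact_mod_cast hd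
  calc ε = ∑ _i : Fin d, ε / d := by
        rw [Finset.sum_const, Finset.card_univ, Fintype.card_fin, nsmul_eq_mul]; field_simp
    _ ≤ ∑ i, (pairLoss e q ε i (z i) + pairLoss e q ε i (!(z i))) :=
        Finset.sum_le_sum fun i _ => pairLoss_add_ge e q h0 i _
    _ ≤ _ := by
        rw [Finset.sum_add_distrib]
        exact add_le_add (sum_pairLoss_le e hd h0 h1 q z) (sum_pairLoss_le e hd h0 h1 q _)

/-! ### Message distributions -/

variable {Y : Type} [Fintype Y]

/-- The law of the message under the channel `W` and the distribution `p`. -/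
def outLaw (W : Channel k Y) (p : FinDist (Fin k)) (y : Y) : ℝ := ∑ x, p.1 x * (W x).1 y

lemma outLaw_nonneg (W : Channel k Y) (p : FinDist (Fin k)) (y : Y) : 0 ≤ outLaw W p y :=
  Finset.sum_nonneg fun x _ => mul_nonneg (p.2.1 x) ((W x).2.1 y)

lemma sum_outLaw (W : Channel k Y) (p : FinDist (Fin k)) : ∑ y, outLaw W p y = 1 := by
  unfold outLaw
  rw [Finset.sum_comm]
  simp only [← Finset.mul_sum, (W _).2.2, mul_one, p.2.2]

/-- The difference of the probabilities of `y` on the two points of a pair. -/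
def pairDiff (W : Channel k Y) (y : Y) (i : Fin d) : ℝ :=
  (W (e (i, true))).1 y - (W (e (i, false))).1 y

/-- The sum of the probabilities of `y` on the two points of a pair. -/
def pairSum (W : Channel k Y) (y : Y) (i : Fin d) : ℝ :=
  (W (e (i, true))).1 y + (W (e (i, false))).1 y

lemma outLaw_pairDist (W : Channel k Y) (z : Fin d → Bool) (y : Y) :
    outLaw W (pairDist e hd h0 h1 z) y
      = (∑ i, pairSum e W y i + ε * signedSum Finset.univ (pairDiff e W y) z) / (2 * d) := by
  rw [outLaw, sum_pairDist_mul, sum_pairWeight_mul]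
  rfl

lemma finDist_le_one {α : Type} [Fintype α] (p : FinDist α) (a : α) : p.1 a ≤ 1 := by
  rw [← p.2.2]; exact Finset.single_le_sum (fun i _ => p.2.1 i) (Finset.mem_univ a)

lemma pairSum_nonneg (W : Channel k Y) (y : Y) (i : Fin d) : 0 ≤ pairSum e W y i :=
  add_nonneg ((W _).2.1 y) ((W _).2.1 y)

lemma abs_pairDiff_le (W : Channel k Y) (y : Y) (i : Fin d) :
    |pairDiff e W y i| ≤ pairSum e W y i := by
  have h1 := (W (e (i, true))).2.1 y
  have h2 := (W (e (i, false))).2.1 y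
  exact abs_le.2 ⟨by simp only [pairDiff, pairSum]; linarith,
    by simp only [pairDiff, pairSum]; linarith⟩

lemma abs_pairDiff_le_one (W : Channel k Y) (y : Y) (i : Fin d) : |pairDiff e W y i| ≤ 1 := by
  have h1 := (W (e (i, true))).2.1 y
  have h2 := (W (e (i, false))).2.1 y
  have h3 := finDist_le_one (W (e (i, true))) y
  have h4 := finDist_le_one (W (e (i, false))) y
  exact abs_le.2 ⟨by simp only [pairDiff]; linarith, by simp only [pairDiff]; linarith⟩

lemma pairDiff_sq_le (W : Channel k Y) (y : Y) (i : Fin d) :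
    pairDiff e W y i ^ 2 ≤ pairSum e W y i := by
  rw [← sq_abs, sq]
  have := abs_pairDiff_le e W y i
  have := abs_pairDiff_le_one e W y i
  nlinarith [abs_nonneg (pairDiff e W y i)]

lemma sum_sum_pairSum (W : Channel k Y) : ∑ y, ∑ i, pairSum e W y i = 2 * d := by
  rw [Finset.sum_comm]
  simp only [pairSum, Finset.sum_add_distrib, (W _).2.2]
  simp
  ring

/-! ### The manipulation lower bound -/

/-- The average distance of the message laws of the hard family from the uniform one. -/
lemma sum_sum_abs_outLaw_sub_le {ℓ₁ : ℝ} (hd : 1 ≤ d) (W : Channel k Y)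
    (hℓ : ℓ₁ = min (Fintype.card Y : ℝ) (2 * d)) :
    ∑ z : Fin d → Bool, ∑ y, |outLaw W (pairDist e hd h0 h1 z) y
        - outLaw W (pairDist e hd le_rfl zero_le_one z) y|
      ≤ 2 ^ d * (ε * √(ℓ₁ / (2 * d))) := by
  have hd0 : (0 : ℝ) < d := by exact_mod_cast hd
  have e1 : ∀ z y, |outLaw W (pairDist e hd h0 h1 z) y
        - outLaw W (pairDist e hd le_rfl zero_le_one z) y|
      = ε / (2 * d) * |signedSum Finset.univ (pairDiff e W y) z| := fun z y => by
    rw [outLaw_pairDist, outLaw_pairDist, ← sub_div, zero_mul, add_zero, add_sub_cancel_left,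
      mul_div_right_comm, abs_mul, abs_of_nonneg (by positivity : 0 ≤ ε / (2 * d))]
  simp only [e1]
  rw [Finset.sum_comm]
  simp only [← Finset.mul_sum]
  have hw0 : ∀ y, 0 ≤ ∑ i, pairSum e W y i := fun y => Finset.sum_nonneg fun i _ =>
    pairSum_nonneg e W y i
  -- Two bounds for each message: this second moment bound, which after Cauchy–Schwarz over the
  -- messages is the better one when `|Y| ≤ 2d`, and the trivial bound `hB`, used for larger message
  -- sets.
  have hA : ∀ y, ∑ z, |signedSum Finset.univ (pairDiff e W y) z|
      ≤ 2 ^ d * √(∑ i, pairSum e W y i) := fun y => by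
    have h2 : (∑ z, |signedSum Finset.univ (pairDiff e W y) z|) ^ 2
        ≤ 2 ^ d * (2 ^ d * ∑ i, pairSum e W y i) := by
      calc (∑ z, |signedSum Finset.univ (pairDiff e W y) z|) ^ 2
          ≤ (Finset.univ : Finset (Fin d → Bool)).card
              * ∑ z, |signedSum Finset.univ (pairDiff e W y) z| ^ 2 := sq_sum_le_card_mul_sum_sq
        _ = 2 ^ d * (2 ^ d * ∑ i, pairDiff e W y i ^ 2) := by
            simp only [sq_abs, sum_signedSum_sq, Finset.card_univ, Fintype.card_fun,
              Fintype.card_bool, Fintype.card_fin]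
            push_cast
            rfl
        _ ≤ _ := by
            gcongr with i
            exact pairDiff_sq_le e W y i
    have h3 := Real.le_sqrt_of_sq_le h2
    rwa [← mul_assoc, Real.sqrt_mul (by positivity), Real.sqrt_mul_self (by positivity)] at h3
  have hB : ∀ y, ∑ z, |signedSum Finset.univ (pairDiff e W y) z|
      ≤ 2 ^ d * ∑ i, pairSum e W y i := fun y => by
    calc ∑ z, |signedSum Finset.univ (pairDiff e W y) z|
        ≤ ∑ _z : Fin d → Bool, ∑ i, pairSum e W y i := by
          refine Finset.sum_le_sum fun z _ => (Finset.abs_sum_le_sum_abs _ _).trans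
            (Finset.sum_le_sum fun i _ => ?_)
          rw [abs_mul, abs_bitSign, one_mul]
          exact abs_pairDiff_le e W y i
      _ = _ := by
          rw [Finset.sum_const, Finset.card_univ, Fintype.card_fun, Fintype.card_bool,
            Fintype.card_fin, nsmul_eq_mul]
          push_cast; rfl
  have hC : ∑ y, ∑ z, |signedSum Finset.univ (pairDiff e W y) z|
      ≤ 2 ^ d * (√(ℓ₁ / (2 * d)) * (2 * d)) := by
    have e2 : √(ℓ₁ / (2 * d)) * (2 * d) = √(ℓ₁ * (2 * d)) := by
      have : ℓ₁ * (2 * d) = ℓ₁ / (2 * d) * (2 * d) ^ 2 := by field_simp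
      rw [this, Real.sqrt_mul' _ (by positivity), Real.sqrt_sq (by positivity)]
    rw [e2]
    rcases le_total (Fintype.card Y : ℝ) (2 * d) with h | h
    · rw [hℓ, min_eq_left h]
      refine (Finset.sum_le_sum fun y _ => hA y).trans ?_
      rw [← Finset.mul_sum]
      refine mul_le_mul_of_nonneg_left (Real.le_sqrt_of_sq_le ?_) (by positivity)
      calc (∑ y, √(∑ i, pairSum e W y i)) ^ 2
          ≤ (Finset.univ : Finset Y).card * ∑ y, √(∑ i, pairSum e W y i) ^ 2 :=
            sq_sum_le_card_mul_sum_sq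
        _ = _ := by
            simp only [Real.sq_sqrt (hw0 _), sum_sum_pairSum, Finset.card_univ]
    · rw [hℓ, min_eq_right h, Real.sqrt_mul_self (by positivity)]
      refine (Finset.sum_le_sum fun y _ => hB y).trans ?_
      rw [← Finset.mul_sum, sum_sum_pairSum]
  calc ε / (2 * d) * ∑ y, ∑ z, |signedSum Finset.univ (pairDiff e W y) z|
      ≤ ε / (2 * d) * (2 ^ d * (√(ℓ₁ / (2 * d)) * (2 * d))) := by gcongr
    _ = _ := by field_simp

lemma outLaw_pairDist_zero (W : Channel k Y) (z z' : Fin d → Bool) :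
    outLaw W (pairDist e hd le_rfl zero_le_one z)
      = outLaw W (pairDist e hd le_rfl zero_le_one z') := by
  funext y
  rw [outLaw_pairDist, outLaw_pairDist, zero_mul, zero_mul]

variable {n : ℕ}

/-- Imitating the message law at `ε = 0`, which does not depend on `z`, would leave the server with
average loss at least `ε/2`, by pairing each `z` with its complement. The failures of the coupling
cost at most `ε/8` on average, by `hε`; what remains is `3ε/8`. -/
lemma sum_best_response_ge [DecidableEq Y] (hn : 1 ≤ n) (W : Fin n → Channel k Y)
    (est : (Fin n → Y) → FinDist (Fin k)) {γ : ℝ} (hγ : 0 < γ)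
    (hε : 4 * (ε * √(min (Fintype.card Y : ℝ) (2 * d) / (2 * d))) ≤ γ)
    {A : (Fin d → Bool) → (Fin n → Y) → (Fin n → Y)}
    (hA : ∀ z y y', (hammingDist y y' : ℝ) ≤ γ * n →
      tvDist (est y') (pairDist e hd h0 h1 z) ≤ tvDist (est (A z y)) (pairDist e hd h0 h1 z)) :
    2 ^ d * (3 / 8 * ε) ≤ ∑ z, ∑ y : Fin n → Y, (∏ i, outLaw (W i) (pairDist e hd h0 h1 z) (y i))
      * tvDist (est (A z y)) (pairDist e hd h0 h1 z) := by
  have hn0 : (0 : ℝ) < n := by exact_mod_cast hn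
  set z0 : Fin d → Bool := fun _ => true
  set Q : Fin n → Y → ℝ := fun i => outLaw (W i) (pairDist e hd le_rfl zero_le_one z0) with hQ
  set τ := √(min (Fintype.card Y : ℝ) (2 * d) / (2 * d)) with hτ
  -- Truncating at `ε` makes a failed coupling cost only `ε` rather than `1`, and the pairing
  -- argument survives it.
  set G : (Fin d → Bool) → (Fin n → Y) → ℝ :=
    fun z y => min (tvDist (est y) (pairDist e hd h0 h1 z)) ε with hG
  have hQ1 : ∀ i, ∑ y, Q i y = 1 := fun i => sum_outLaw _ _
  have hgain : ∀ z, ∑ y : Fin n → Y, (∏ i, Q i (y i)) * G z y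
      - ε * ((1 / 2) * ∑ i, ∑ y, |outLaw (W i) (pairDist e hd h0 h1 z) y - Q i y|) / (γ * n)
      ≤ ∑ y : Fin n → Y, (∏ i, outLaw (W i) (pairDist e hd h0 h1 z) (y i))
        * tvDist (est (A z y)) (pairDist e hd h0 h1 z) := fun z =>
    attack_gain (fun i y => outLaw_nonneg _ _ y) (fun i y => outLaw_nonneg _ _ y)
      (fun i => sum_outLaw _ _) hQ1 (by positivity) h0 (fun y => min_le_right _ _)
      (fun y => tvDist_nonneg _ _) fun y y' h => (min_le_left _ _).trans (hA z y y' h)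
  refine le_trans ?_ (Finset.sum_le_sum fun z _ => hgain z)
  have hcardZ : ((Finset.univ : Finset (Fin d → Bool)).card : ℝ) = 2 ^ d := by
    simp [Finset.card_univ]
  have hG2 : ∀ y, 2 ^ d * (ε / 2) ≤ ∑ z, G z y := fun y => by
    have hneg : ∑ z, G z y = ∑ z : Fin d → Bool, G (fun i => !(z i)) y :=
      Fintype.sum_equiv (Equiv.arrowCongr (Equiv.refl _) Equiv.boolNot) _ _ fun z => by
        congr 1; funext i; simp [Equiv.arrowCongr]
    have : 2 ^ d * ε ≤ ∑ z : Fin d → Bool, (G z y + G (fun i => !(z i)) y) := by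
      rw [← hcardZ, ← nsmul_eq_mul]
      refine Finset.card_nsmul_le_sum _ _ _ fun z _ => ?_
      have h := tvDist_add_ge e hd h0 h1 (est y) z
      have t1 := tvDist_nonneg (est y) (pairDist e hd h0 h1 z)
      have t2 := tvDist_nonneg (est y) (pairDist e hd h0 h1 fun i => !(z i))
      simp only [hG]
      rcases min_cases (tvDist (est y) (pairDist e hd h0 h1 z)) ε with ⟨h1', -⟩ | ⟨h1', -⟩ <;>
      rcases min_cases (tvDist (est y) (pairDist e hd h0 h1 fun i => !(z i))) ε with
        ⟨h2', -⟩ | ⟨h2', -⟩ <;> rw [h1', h2'] <;> linarith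
    rw [Finset.sum_add_distrib, ← hneg] at this
    linarith
  have hfirst : 2 ^ d * (ε / 2) ≤ ∑ z, ∑ y : Fin n → Y, (∏ i, Q i (y i)) * G z y := by
    rw [Finset.sum_comm]
    calc 2 ^ d * (ε / 2) = ∑ y : Fin n → Y, (∏ i, Q i (y i)) * (2 ^ d * (ε / 2)) := by
          rw [← Finset.sum_mul, sum_prod_weights_eq_one hQ1, one_mul]
      _ ≤ ∑ y : Fin n → Y, (∏ i, Q i (y i)) * ∑ z, G z y :=
          Finset.sum_le_sum fun y _ => mul_le_mul_of_nonneg_left (hG2 y)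
            (Finset.prod_nonneg fun i _ => outLaw_nonneg _ _ _)
      _ = _ := by simp only [Finset.mul_sum]
  have hsecond : ∑ z : Fin d → Bool, ∑ i, ∑ y, |outLaw (W i) (pairDist e hd h0 h1 z) y - Q i y|
      ≤ n * (2 ^ d * (ε * τ)) := by
    rw [Finset.sum_comm]
    calc _ ≤ ∑ _i : Fin n, 2 ^ d * (ε * τ) := by
          refine Finset.sum_le_sum fun i _ => ?_
          have := sum_sum_abs_outLaw_sub_le e h0 h1 hd (W i) rfl
          simp only [outLaw_pairDist_zero e hd (W i) _ z0] at this
          exact this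
      _ = _ := by
          rw [Finset.sum_const, Finset.card_univ, Fintype.card_fin, nsmul_eq_mul]
  rw [Finset.sum_sub_distrib, ← Finset.sum_div, ← Finset.mul_sum, ← Finset.mul_sum]
  have hthird : ε * ((1 / 2) * ∑ z : Fin d → Bool, ∑ i, ∑ y,
      |outLaw (W i) (pairDist e hd h0 h1 z) y - Q i y|) / (γ * n) ≤ 2 ^ d * (ε / 8) := by
    rw [div_le_iff₀ (by positivity)]
    calc _ ≤ ε * ((1 / 2) * (n * (2 ^ d * (ε * τ)))) := by gcongr
      _ = (n * (2 ^ d * ε) / 8) * (4 * (ε * τ)) := by ring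
      _ ≤ (n * (2 ^ d * ε) / 8) * γ := by gcongr
      _ = _ := by ring
  linarith

/-! ### The sampling lower bound -/

/-- Flipping the sign of the pair `i`. -/
def flip (i : Fin d) (z : Fin d → Bool) : Fin d → Bool := Function.update z i (!(z i))

lemma flip_flip (i : Fin d) (z : Fin d → Bool) : flip i (flip i z) = z := by
  simp [flip]

lemma flip_self (i : Fin d) (z : Fin d → Bool) : flip i z i = !(z i) := by simp [flip]

lemma sum_flip (i : Fin d) (F : (Fin d → Bool) → ℝ) : ∑ z, F (flip i z) = ∑ z, F z :=
  Fintype.sum_bijective (flip i) (Function.Involutive.bijective (flip_flip i)) _ _ fun _ => rfl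

lemma signedSum_sub_flip (v : Fin d → ℝ) (i : Fin d) (z : Fin d → Bool) :
    signedSum Finset.univ v z - signedSum Finset.univ v (flip i z) = 2 * (bitSign (z i) * v i) := by
  rw [← Finset.insert_erase (Finset.mem_univ i), signedSum_insert (Finset.notMem_erase _ _),
    signedSum_insert (Finset.notMem_erase _ _), flip_self, bitSign_not]
  rw [flip, signedSum_update (Finset.notMem_erase _ _)]
  ring

/-- The information about the signs of the pairs in one message. -/
lemma sum_chiSq_le (hd : 1 ≤ d) (hε : ε ≤ 1 / 2) (W : Channel k Y) (z : Fin d → Bool) :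
    ∑ i, ∑ y, (outLaw W (pairDist e hd h0 h1 z) y - outLaw W (pairDist e hd h0 h1 (flip i z)) y) ^ 2
        / (outLaw W (pairDist e hd h0 h1 z) y + outLaw W (pairDist e hd h0 h1 (flip i z)) y)
      ≤ 2 * ε ^ 2 / d * min (Fintype.card Y : ℝ) (2 * d) := by
  have hd0 : (0 : ℝ) < d := by exact_mod_cast hd
  have hw0 : ∀ y, 0 ≤ ∑ i, pairSum e W y i := fun y => Finset.sum_nonneg fun i _ =>
    pairSum_nonneg e W y i
  -- `ε ≤ 1/2` keeps at least half of the unperturbed mass of each message, so the chi-square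
  -- denominators can be replaced by it.
  have hlow : ∀ z' y, (∑ i, pairSum e W y i) / (4 * d) ≤ outLaw W (pairDist e hd h0 h1 z') y := by
    intro z' y
    have hs : |signedSum Finset.univ (pairDiff e W y) z'| ≤ ∑ i, pairSum e W y i := by
      refine (Finset.abs_sum_le_sum_abs _ _).trans (Finset.sum_le_sum fun i _ => ?_)
      rw [abs_mul, abs_bitSign, one_mul]
      exact abs_pairDiff_le e W y i
    have := (abs_le.1 hs).1
    rw [outLaw_pairDist, div_le_div_iff₀ (by positivity) (by positivity)]
    have h3 : (∑ i, pairSum e W y i) / 2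
        ≤ ∑ i, pairSum e W y i + ε * signedSum Finset.univ (pairDiff e W y) z' := by
      nlinarith [hw0 y]
    nlinarith
  have hterm : ∀ i y,
      (outLaw W (pairDist e hd h0 h1 z) y - outLaw W (pairDist e hd h0 h1 (flip i z)) y) ^ 2
        / (outLaw W (pairDist e hd h0 h1 z) y + outLaw W (pairDist e hd h0 h1 (flip i z)) y)
      ≤ 2 * ε ^ 2 / d * (pairDiff e W y i ^ 2 / ∑ j, pairSum e W y j) := by
    intro i y
    have hnum : (outLaw W (pairDist e hd h0 h1 z) y
        - outLaw W (pairDist e hd h0 h1 (flip i z)) y) ^ 2 = ε ^ 2 / d ^ 2 * pairDiff e W y i ^ 2 := by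
      rw [outLaw_pairDist, outLaw_pairDist, ← sub_div, add_sub_add_left_eq_sub, ← mul_sub,
        signedSum_sub_flip, div_pow, mul_pow, mul_pow, mul_pow, bitSign_sq]
      field_simp
    rw [hnum]
    rcases (hw0 y).eq_or_lt with h | h
    · have : pairDiff e W y i = 0 := by
        have h2 : pairSum e W y i ≤ 0 := by
          rw [h]; exact Finset.single_le_sum (fun i _ => pairSum_nonneg e W y i)
            (Finset.mem_univ i)
        exact abs_eq_zero.1 (le_antisymm ((abs_pairDiff_le e W y i).trans h2) (abs_nonneg _))
      rw [this]; simp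
    · have hden : (∑ j, pairSum e W y j) / (2 * d) ≤ outLaw W (pairDist e hd h0 h1 z) y
          + outLaw W (pairDist e hd h0 h1 (flip i z)) y := by
        have := hlow z y
        have := hlow (flip i z) y
        have e3 : (∑ j, pairSum e W y j) / (2 * d) = (∑ j, pairSum e W y j) / (4 * d)
          + (∑ j, pairSum e W y j) / (4 * d) := by field_simp; ring
        linarith
      calc _ ≤ ε ^ 2 / d ^ 2 * pairDiff e W y i ^ 2 / ((∑ j, pairSum e W y j) / (2 * d)) := by
            gcongr
        _ = _ := by field_simp
  -- Each ratio is at most `1`, by `pairDiff² ≤ pairSum`, which counts messages; it is also at most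
  -- the total `pairSum` of the message, and these totals add up to `2d`.
  have hsum : ∑ y, (∑ i, pairDiff e W y i ^ 2) / ∑ j, pairSum e W y j
      ≤ min (Fintype.card Y : ℝ) (2 * d) := by
    refine le_min ?_ ?_
    · calc _ ≤ ∑ _y : Y, (1 : ℝ) := Finset.sum_le_sum fun y _ =>
            div_le_one_of_le₀ (Finset.sum_le_sum fun i _ => pairDiff_sq_le e W y i) (hw0 y)
        _ = _ := by simp
    · rw [← sum_sum_pairSum e W]
      refine Finset.sum_le_sum fun y _ => ?_
      refine div_le_of_le_mul₀ (hw0 y) (hw0 y) ?_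
      rw [Finset.sum_mul]
      refine Finset.sum_le_sum fun i _ => ?_
      have h2 : pairSum e W y i ≤ ∑ j, pairSum e W y j :=
        Finset.single_le_sum (fun i _ => pairSum_nonneg e W y i) (Finset.mem_univ i)
      have h3 := abs_pairDiff_le e W y i
      rw [← sq_abs, sq]
      exact mul_le_mul h3 (h3.trans h2) (abs_nonneg _) (pairSum_nonneg e W y i)
  calc _ ≤ ∑ i, ∑ y, 2 * ε ^ 2 / d * (pairDiff e W y i ^ 2 / ∑ j, pairSum e W y j) :=
        Finset.sum_le_sum fun i _ => Finset.sum_le_sum fun y _ => hterm i y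
    _ = 2 * ε ^ 2 / d * ∑ y, (∑ i, pairDiff e W y i ^ 2) / ∑ j, pairSum e W y j := by
        rw [Finset.sum_comm]
        simp only [Finset.mul_sum, Finset.sum_div]
    _ ≤ _ := by gcongr

/-- Assouad's method: for each pair, `z` is matched with its flip, and on the overlap of the two
message laws the losses of that pair add up to at least `ε/d`. The overlap need not be large for
every pair, since a channel may concentrate its information on a few; only the sum of the chi-square
terms over the pairs is controlled, by `d/2`. -/
lemma sum_loss_ge (hn : 1 ≤ n) (W : Fin n → Channel k Y) (est : (Fin n → Y) → FinDist (Fin k))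
    (hε : ε ≤ 1 / 2) (hε2 : 4 * ε ^ 2 * (n * min (Fintype.card Y : ℝ) (2 * d)) ≤ d ^ 2) :
    2 ^ d * (ε / 8) ≤ ∑ z, ∑ y : Fin n → Y, (∏ i, outLaw (W i) (pairDist e hd h0 h1 z) (y i))
      * tvDist (est y) (pairDist e hd h0 h1 z) := by
  have hd0 : (0 : ℝ) < d := by exact_mod_cast hd
  have hn0 : (0 : ℝ) < n := by exact_mod_cast hn
  set P : (Fin d → Bool) → (Fin n → Y) → ℝ :=
    fun z y => ∏ j, outLaw (W j) (pairDist e hd h0 h1 z) (y j) with hP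
  have hP0 : ∀ z y, 0 ≤ P z y := fun z y => Finset.prod_nonneg fun j _ => outLaw_nonneg _ _ _
  set χ : Fin d → Fin n → (Fin d → Bool) → ℝ := fun i j z => ∑ y,
    (outLaw (W j) (pairDist e hd h0 h1 z) y - outLaw (W j) (pairDist e hd h0 h1 (flip i z)) y) ^ 2
    / (outLaw (W j) (pairDist e hd h0 h1 z) y + outLaw (W j) (pairDist e hd h0 h1 (flip i z)) y)
    with hχ
  have hpair : ∀ i, (ε / (2 * d)) * ∑ z, (1 - ∑ j, χ i j z)
      ≤ 2 * ∑ z, ∑ y, P z y * pairLoss e (est y) ε i (z i) := by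
    intro i
    have hflip := sum_flip i fun z => ∑ y, P z y * pairLoss e (est y) ε i (z i)
    have htwo : 2 * ∑ z, ∑ y, P z y * pairLoss e (est y) ε i (z i)
        = ∑ z, ∑ y, (P z y * pairLoss e (est y) ε i (z i)
          + P (flip i z) y * pairLoss e (est y) ε i (!(z i))) := by
      simp only [flip_self] at hflip
      simp only [Finset.sum_add_distrib]
      rw [hflip]; ring
    rw [htwo, Finset.mul_sum]
    refine Finset.sum_le_sum fun z _ => ?_
    calc ε / (2 * d) * (1 - ∑ j, χ i j z) = ((1 / 2) * (1 - ∑ j, χ i j z)) * (ε / d) := by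
          field_simp
      _ ≤ (∑ y, min (P z y) (P (flip i z) y)) * (ε / d) := by
          refine mul_le_mul_of_nonneg_right ?_ (by positivity)
          exact sum_min_prod_ge (fun j y => outLaw_nonneg _ _ _) (fun j y => outLaw_nonneg _ _ _)
            (fun j => sum_outLaw _ _) (fun j => sum_outLaw _ _)
      _ ≤ _ := by
          rw [Finset.sum_mul]
          refine Finset.sum_le_sum fun y _ => ?_
          have hm0 : 0 ≤ min (P z y) (P (flip i z) y) := le_min (hP0 _ _) (hP0 _ _)
          calc _ ≤ min (P z y) (P (flip i z) y)
                * (pairLoss e (est y) ε i (z i) + pairLoss e (est y) ε i (!(z i))) :=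
                mul_le_mul_of_nonneg_left (pairLoss_add_ge e (est y) h0 i (z i)) hm0
            _ ≤ _ := by
                rw [mul_add]
                exact add_le_add
                  (mul_le_mul_of_nonneg_right (min_le_left _ _) (pairLoss_nonneg e _ _ _ _))
                  (mul_le_mul_of_nonneg_right (min_le_right _ _) (pairLoss_nonneg e _ _ _ _))
  have hχsum : ∀ z, ∑ i, ∑ j, χ i j z ≤ d / 2 := by
    intro z
    rw [Finset.sum_comm]
    calc ∑ j, ∑ i, χ i j z
        ≤ ∑ _j : Fin n, 2 * ε ^ 2 / d * min (Fintype.card Y : ℝ) (2 * d) :=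
          Finset.sum_le_sum fun j _ => sum_chiSq_le e h0 h1 hd hε (W j) z
      _ = (4 * ε ^ 2 * (n * min (Fintype.card Y : ℝ) (2 * d))) / (2 * d) := by
          rw [Finset.sum_const, Finset.card_univ, Fintype.card_fin, nsmul_eq_mul]
          field_simp
          ring
      _ ≤ d ^ 2 / (2 * d) := by gcongr
      _ = d / 2 := by field_simp
  have hcardZ : ((Finset.univ : Finset (Fin d → Bool)).card : ℝ) = 2 ^ d := by
    simp [Finset.card_univ]
  have hsum : 2 ^ d * (d / 2 : ℝ) ≤ ∑ i, ∑ z, (1 - ∑ j, χ i j z) := by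
    rw [Finset.sum_comm, ← hcardZ, ← nsmul_eq_mul]
    refine Finset.card_nsmul_le_sum _ _ _ fun z _ => ?_
    rw [Finset.sum_sub_distrib]
    have := hχsum z
    simp only [Finset.sum_const, Finset.card_univ, Fintype.card_fin, nsmul_eq_mul, mul_one]
    linarith
  have htotal : ∑ i, ∑ z, ∑ y, P z y * pairLoss e (est y) ε i (z i)
      ≤ ∑ z, ∑ y, P z y * tvDist (est y) (pairDist e hd h0 h1 z) := by
    rw [Finset.sum_comm]
    refine Finset.sum_le_sum fun z _ => ?_
    rw [Finset.sum_comm]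
    refine Finset.sum_le_sum fun y _ => ?_
    rw [← Finset.mul_sum]
    exact mul_le_mul_of_nonneg_left (sum_pairLoss_le e hd h0 h1 (est y) z) (hP0 z y)
  refine le_trans ?_ htotal
  have h5 := Finset.sum_le_sum fun i (_ : i ∈ Finset.univ) => hpair i
  rw [← Finset.mul_sum, ← Finset.mul_sum] at h5
  have h6 : ε / (2 * d) * (2 ^ d * (d / 2 : ℝ)) ≤ ε / (2 * d) * ∑ i, ∑ z, (1 - ∑ j, χ i j z) :=
    mul_le_mul_of_nonneg_left hsum (by positivity)
  have h7 : ε / (2 * d) * (2 ^ d * (d / 2 : ℝ)) = 2 * (2 ^ d * (ε / 8)) := by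
    field_simp; ring
  linarith

end PairFamily

/-! ### The lower bound -/

section LowerBound

variable {k n ℓ : ℕ} {γ : ℝ}

lemma exists_pair_embedding (k : ℕ) : Nonempty (Fin (k / 2) × Bool ↪ Fin k) := by
  rw [Function.Embedding.nonempty_iff_card_le]
  simp only [Fintype.card_prod, Fintype.card_fin, Fintype.card_bool]
  omega

lemma card_messages (ℓ : ℕ) : (Fintype.card (Fin ℓ → Bool) : ℝ) = 2 ^ ℓ := by simp

lemma sampling_le_riskDL (hk : 2 ≤ k) (hn : 1 ≤ n) (hγ : 0 ≤ γ) :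
    ENNReal.ofReal (1 / 48 * min 1 √((k : ℝ) ^ 2 / ((n : ℝ) * min ((2 : ℝ) ^ ℓ) (k : ℝ))))
      ≤ riskDL k n (commChannels k ℓ) γ := by
  obtain ⟨e⟩ := exists_pair_embedding k
  have hd : 1 ≤ k / 2 := by omega
  -- Odd `k` leaves one point unpaired; the factor `3` is attained at `k = 3`.
  have hkd : (k : ℝ) ≤ 3 * ((k / 2 : ℕ) : ℝ) := by
    exact_mod_cast (by omega : k ≤ 3 * (k / 2))
  have hdk : 2 * ((k / 2 : ℕ) : ℝ) ≤ k := by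
    exact_mod_cast (by omega : 2 * (k / 2) ≤ k)
  have hd0 : (0 : ℝ) < ((k / 2 : ℕ) : ℝ) := by exact_mod_cast hd
  have hn0 : (0 : ℝ) < n := by exact_mod_cast hn
  generalize k / 2 = d at *
  have hk0 : (0 : ℝ) < k := by linarith
  set m := min ((2 : ℝ) ^ ℓ) (2 * d) with hm
  set L := min ((2 : ℝ) ^ ℓ) (k : ℝ) with hL
  have hm0 : 0 < m := lt_min (by positivity) (by positivity)
  have hmL : m ≤ L := min_le_min le_rfl hdk
  have hL0 : 0 < L := hm0.trans_le hmL
  -- The largest `ε ≤ 1/2` with `4 ε² n m ≤ d²`, the information budget of `sum_loss_ge`.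
  set ε : ℝ := min (1 / 2) (d / (2 * √(n * m))) with hε
  have h0 : 0 ≤ ε := by positivity
  have hε2 : ε ≤ 1 / 2 := min_le_left _ _
  have h1 : ε ≤ 1 := by linarith
  have hsq : 4 * ε ^ 2 * (n * m) ≤ d ^ 2 := by
    have h2 : ε ^ 2 ≤ (d / (2 * √(n * m))) ^ 2 := by
      gcongr; exact min_le_right _ _
    rw [div_pow, mul_pow, Real.sq_sqrt (by positivity), le_div_iff₀ (by positivity)] at h2
    linarith
  have hb : 1 / 48 * min 1 √((k : ℝ) ^ 2 / (n * L)) ≤ ε / 8 := by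
    have h2 : 1 / 6 * min 1 √((k : ℝ) ^ 2 / (n * L)) ≤ ε := by
      refine le_min ?_ ?_
      · linarith [min_le_left 1 √((k : ℝ) ^ 2 / (n * L))]
      · have h3 : √((k : ℝ) ^ 2 / (n * L)) = k / √(n * L) := by
          rw [Real.sqrt_div (by positivity), Real.sqrt_sq hk0.le]
        calc 1 / 6 * min 1 √((k : ℝ) ^ 2 / (n * L)) ≤ 1 / 6 * (k / √(n * L)) := by
              rw [← h3]; gcongr; exact min_le_right _ _
          _ ≤ 1 / 6 * (3 * d / √(n * m)) := by gcongr
          _ = _ := by field_simp; norm_num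
    linarith
  refine (ENNReal.ofReal_le_ofReal hb).trans (le_iInf fun S => ?_)
  refine S.le_iSup_expectedLoss (fun z => pairDist e hd h0 h1 z) (fun _ => Attack.id S hγ)
    fun ω => ?_
  have h := sum_loss_ge e hd h0 h1 hn (S.channel ω) (S.estimator ω) hε2
    (by rw [card_messages]; exact hsq)
  rw [card_messages]
  exact h

lemma manipulation_le_riskDL (hk : 2 ≤ k) (hn : 1 ≤ n) (hγ : 0 ≤ γ) :
    ENNReal.ofReal (1 / 48 * min 1 (γ * √((k : ℝ) / min ((2 : ℝ) ^ ℓ) (k : ℝ))))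
      ≤ riskDL k n (commChannels k ℓ) γ := by
  -- For `γ = 0` the bound is trivial; otherwise the budget `γ n` is positive, as Markov's
  -- inequality requires.
  rcases hγ.eq_or_lt with rfl | hγ0
  · simp
  obtain ⟨e⟩ := exists_pair_embedding k
  have hd : 1 ≤ k / 2 := by omega
  have hkd : (k : ℝ) ≤ 3 * ((k / 2 : ℕ) : ℝ) := by
    exact_mod_cast (by omega : k ≤ 3 * (k / 2))
  have hdk : 2 * ((k / 2 : ℕ) : ℝ) ≤ k := by
    exact_mod_cast (by omega : 2 * (k / 2) ≤ k)
  have hd0 : (0 : ℝ) < ((k / 2 : ℕ) : ℝ) := by exact_mod_cast hd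
  generalize k / 2 = d at *
  have hk0 : (0 : ℝ) < k := by linarith
  set m := min ((2 : ℝ) ^ ℓ) (2 * d) with hm
  set L := min ((2 : ℝ) ^ ℓ) (k : ℝ) with hL
  have hm0 : 0 < m := lt_min (by positivity) (by positivity)
  have hmL : m ≤ L := min_le_min le_rfl hdk
  have hL0 : 0 < L := hm0.trans_le hmL
  set τ := √(m / (2 * d)) with hτ
  have hτ0 : 0 < τ := Real.sqrt_pos.2 (by positivity)
  -- The largest `ε ≤ 1` with `4 ε τ ≤ γ`, so that the expected number of changes the coupling
  -- needs, averaged over the signs, is at most `γ n / 8`.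
  set ε : ℝ := min 1 (γ / (4 * τ)) with hε
  have h0 : 0 ≤ ε := by positivity
  have h1 : ε ≤ 1 := min_le_left _ _
  have hcost : 4 * (ε * τ) ≤ γ := by
    have : ε ≤ γ / (4 * τ) := min_le_right _ _
    rw [le_div_iff₀ (by positivity)] at this
    linarith
  have hb : 1 / 48 * min 1 (γ * √(k / L)) ≤ 3 / 8 * ε := by
    have h2 : 1 / 8 * min 1 (γ * √(k / L)) ≤ ε := by
      refine le_min ?_ ?_
      · linarith [min_le_left 1 (γ * √(k / L))]
      · have h3 : τ * √(k / L) ≤ 2 := by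
          rw [hτ, ← Real.sqrt_mul (by positivity)]
          refine Real.sqrt_le_iff.2 ⟨by norm_num, ?_⟩
          rw [div_mul_div_comm, div_le_iff₀ (by positivity)]
          nlinarith [mul_le_mul hmL hkd hk0.le hL0.le, mul_pos hd0 hL0]
        rw [le_div_iff₀ (by positivity)]
        calc 1 / 8 * min 1 (γ * √(k / L)) * (4 * τ) ≤ 1 / 8 * (γ * √(k / L)) * (4 * τ) := by
              gcongr; exact min_le_right _ _
          _ = γ * (τ * √(k / L)) / 2 := by ring
          _ ≤ γ * 2 / 2 := by gcongr
          _ = γ := by ring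
    linarith
  refine (ENNReal.ofReal_le_ofReal hb).trans (le_iInf fun S => ?_)
  -- The coupling describes a randomized attack, while an `Attack` is deterministic; the best
  -- response does at least as well as any randomization within the same budget.
  choose M hM using fun z => S.exists_best_attack hγ (pairDist e hd h0 h1 z)
  refine S.le_iSup_expectedLoss (fun z => pairDist e hd h0 h1 z) M fun ω => ?_
  have h := sum_best_response_ge e hd h0 h1 hn (S.channel ω) (S.estimator ω) hγ0
    (by rw [card_messages]; exact hcost) (A := fun z => (M z).map ω) fun z => hM z ω
  rw [card_messages]
  exact h

/-- The capped sum is at most twice the larger capped term, which halves the constant `1/48`. -/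
lemma le_riskDL (hk : 2 ≤ k) (hn : 1 ≤ n) (hγ : 0 ≤ γ) :
    ENNReal.ofReal (1 / 96 * lbitRate k n ℓ γ) ≤ riskDL k n (commChannels k ℓ) γ := by
  have h1 := sampling_le_riskDL (ℓ := ℓ) hk hn hγ
  have h2 := manipulation_le_riskDL (ℓ := ℓ) hk hn hγ
  rw [lbitRate]
  set A := √((k : ℝ) ^ 2 / ((n : ℝ) * min ((2 : ℝ) ^ ℓ) (k : ℝ)))
  set B := γ * √((k : ℝ) / min ((2 : ℝ) ^ ℓ) (k : ℝ))
  rcases le_total A B with h | h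
  · refine (ENNReal.ofReal_le_ofReal ?_).trans h2
    have : min 1 (A + B) ≤ 2 * min 1 B := by
      rw [mul_min_of_nonneg _ _ (by norm_num)]
      exact min_le_min (by norm_num) (by linarith)
    linarith
  · refine (ENNReal.ofReal_le_ofReal ?_).trans h1
    have : min 1 (A + B) ≤ 2 * min 1 A := by
      rw [mul_min_of_nonneg _ _ (by norm_num)]
      exact min_le_min (by norm_num) (by linarith)
    linarith

end LowerBound

end ManipulationLearning

end

theorem theorem7 :
    ∃ (c C : ℝ) (a : ℕ), 0 < c ∧ 0 < C ∧
      ∀ (k n ℓ : ℕ) (γ : ℝ), 2 ≤ k → 1 ≤ n → 1 ≤ ℓ → 0 ≤ γ → γ ≤ 1 →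
        ENNReal.ofReal (c * ManipulationLearning.lbitRate k n ℓ γ) ≤
            ManipulationLearning.riskDL k n (ManipulationLearning.commChannels k ℓ) γ ∧
          ManipulationLearning.riskDL k n (ManipulationLearning.commChannels k ℓ) γ ≤
            ENNReal.ofReal
              (C * Real.log ((k : ℝ) * n) ^ a * ManipulationLearning.lbitRate k n ℓ γ) :=
  ⟨1 / 96, 130, 1, by norm_num, by norm_num, fun _ _ _ _ hk hn hℓ hγ _ =>
    ⟨ManipulationLearning.le_riskDL hk hn hγ, ManipulationLearning.riskDL_le hk hn hℓ hγ⟩⟩
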